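/- Let $n \ge 2$, $1 < p < \infty$, and let $\Omega \subset \mathbb{R}^n$ be a bounded open set such that $\overline{\Omega}$ is strictly convex (that is, for any two distinct points of $\overline\Omega$ the open segment between them lies in the interior of $\overline\Omega$). Let $W^{1,p}(\Omega)$ be the real Sobolev space, $W^{1,p}_0(\Omega)$ the closure of $C_c^\infty(\Omega)$ in it, $X := W^{1,p}(\Omega)/W^{1,p}_0(\Omega)$, and $X'$ the dual of $X$. For a positive function $\sigma \in C(\overline\Omega)$ the nonlinear Dirichlet-to-Neumann map $\Lambda_\sigma : X \to X'$ is defined by $$ (\Lambda_\sigma(f), g) = \int_\Omega \sigma\, |\nabla u|^{p-2}\, \nabla u \cdot \nabla v \, dx , \qquad f, g \in X, $$ where $v \in W^{1,p}(\Omega)$ is any representative of $g$ and $u = u_\sigma^f$ is the unique minimizer of the energy $E_\sigma(w) = \int_\Omega \sigma |\nabla w|^p\,dx$ among all $w \in W^{1,p}(\Omega)$ whose class in $X$ is $f$. Then $\Lambda_\sigma$ determines $\sigma$ on the boundary $\partial\overline\Omega$ of the strictly convex set $\overline\Omega$: if $\sigma_1, \sigma_2 \in C(\overline\Omega)$ are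 positive and $\Lambda_{\sigma_1} = \Lambda_{\sigma_2}$, then $\sigma_1 = \sigma_2$ on $\partial\overline\Omega$. In particular, if $\Omega$ is convex, then $\partial\Omega = \partial\overline\Omega$ and $\sigma_1 = \sigma_2$ on $\partial\Omega$. -/

import Mathlib

open MeasureTheory Set
open scoped ContDiff ENNReal Gradient

/-- An exponent `p > 1` satisfies the condition `1 ≤ p` under which `L^p` is a normed space. -/
instance fact_one_le_ofReal {p : ℝ} [hp : Fact (1 < p)] : Fact (1 ≤ ENNReal.ofReal p) :=
  ⟨by simpa using hp.out.le⟩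

/-- `φ ∈ C_c^∞(Ω)`. -/
def IsTestFunction {n : ℕ} (Ω : Set (EuclideanSpace ℝ (Fin n)))
    (φ : EuclideanSpace ℝ (Fin n) → ℝ) : Prop :=
  ContDiff ℝ ∞ φ ∧ HasCompactSupport φ ∧ tsupport φ ⊆ Ω

theorem IsTestFunction.continuous_gradient {n : ℕ} {Ω : Set (EuclideanSpace ℝ (Fin n))}
    {φ : EuclideanSpace ℝ (Fin n) → ℝ} (h : IsTestFunction Ω φ) : Continuous (∇ φ) :=
  (InnerProductSpace.toDual ℝ (EuclideanSpace ℝ (Fin n))).symm.continuous.comp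
    (h.1.continuous_fderiv (by simp))

theorem IsTestFunction.hasCompactSupport_gradient {n : ℕ} {Ω : Set (EuclideanSpace ℝ (Fin n))}
    {φ : EuclideanSpace ℝ (Fin n) → ℝ} (h : IsTestFunction Ω φ) : HasCompactSupport (∇ φ) :=
  (h.2.1.fderiv (𝕜 := ℝ)).comp_left
    (g := (InnerProductSpace.toDual ℝ (EuclideanSpace ℝ (Fin n))).symm) (map_zero _)

theorem IsTestFunction.smul {n : ℕ} {Ω : Set (EuclideanSpace ℝ (Fin n))}
    {φ : EuclideanSpace ℝ (Fin n) → ℝ} (h : IsTestFunction Ω φ) (c : ℝ) :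
    IsTestFunction Ω (c • φ) :=
  ⟨h.1.const_smul c, h.2.1.smul_left (f := fun _ => c),
    (tsupport_smul_subset_right (fun _ => c) φ).trans h.2.2⟩

theorem IsTestFunction.gradient_add {n : ℕ} {Ω : Set (EuclideanSpace ℝ (Fin n))}
    {φ ψ : EuclideanSpace ℝ (Fin n) → ℝ} (hφ : IsTestFunction Ω φ) (hψ : IsTestFunction Ω ψ)
    (x : EuclideanSpace ℝ (Fin n)) : ∇ (φ + ψ) x = ∇ φ x + ∇ ψ x := by
  simp only [gradient]
  rw [fderiv_add (hφ.1.differentiable (by simp) x) (hψ.1.differentiable (by simp) x), map_add]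

theorem IsTestFunction.gradient_smul {n : ℕ} {Ω : Set (EuclideanSpace ℝ (Fin n))}
    {φ : EuclideanSpace ℝ (Fin n) → ℝ} (hφ : IsTestFunction Ω φ) (c : ℝ)
    (x : EuclideanSpace ℝ (Fin n)) : ∇ (c • φ) x = c • ∇ φ x := by
  have h : HasFDerivAt (c • φ) (c • fderiv ℝ φ x) x :=
    (hφ.1.differentiable (by simp) x).hasFDerivAt.const_smul c
  simp only [gradient]
  rw [h.fderiv]
  simp

/-- The field `G` is the weak gradient of `u` in `Ω`. -/
def HasWeakGradient {n : ℕ} (Ω : Set (EuclideanSpace ℝ (Fin n)))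
    (u : EuclideanSpace ℝ (Fin n) → ℝ)
    (G : EuclideanSpace ℝ (Fin n) → EuclideanSpace ℝ (Fin n)) : Prop :=
  ∀ φ : EuclideanSpace ℝ (Fin n) → ℝ, IsTestFunction Ω φ →
    ∫ x in Ω, u x • ∇ φ x = -∫ x in Ω, φ x • G x

section Sobolev

variable {n : ℕ} (p : ℝ) [Fact (1 < p)] (Ω : Set (EuclideanSpace ℝ (Fin n)))

/-- The Sobolev space `W^{1,p}(Ω)`: the pairs `(u, ∇u)` of a function `u ∈ L^p(Ω)` and its weak
gradient `∇u ∈ L^p(Ω; ℝⁿ)`, normed as a subspace of `L^p(Ω) × L^p(Ω; ℝⁿ)` (this norm is equivalent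
to the usual norm of `W^{1,p}(Ω)`). -/
def SobolevW : Submodule ℝ (Lp ℝ (ENNReal.ofReal p) (volume.restrict Ω) ×
    Lp (EuclideanSpace ℝ (Fin n)) (ENNReal.ofReal p) (volume.restrict Ω)) where
  carrier := {w | HasWeakGradient Ω w.1 w.2}
  zero_mem' := by
    intro φ _
    have h1 : ∫ x in Ω, (0 : Lp ℝ (ENNReal.ofReal p) (volume.restrict Ω)) x • ∇ φ x = 0 := by
      apply integral_eq_zero_of_ae
      filter_upwards [Lp.coeFn_zero ℝ (ENNReal.ofReal p) (volume.restrict Ω)] with x hx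
      rw [hx]
      exact zero_smul ℝ _
    have h2 : ∫ x in Ω, φ x • (0 : Lp (EuclideanSpace ℝ (Fin n)) (ENNReal.ofReal p)
        (volume.restrict Ω)) x = 0 := by
      apply integral_eq_zero_of_ae
      filter_upwards [Lp.coeFn_zero (EuclideanSpace ℝ (Fin n)) (ENNReal.ofReal p)
        (volume.restrict Ω)] with x hx
      rw [hx]
      exact smul_zero _
    simp only [Prod.fst_zero, Prod.snd_zero]
    rw [h1, h2, neg_zero]
  add_mem' := by
    rintro ⟨u, G⟩ ⟨v, H⟩ hu hv φ hφ
    have one_le : (1 : ℝ≥0∞) ≤ ENNReal.ofReal p := Fact.out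
    have iu := ((Lp.memLp u).locallyIntegrable one_le).integrable_smul_right_of_hasCompactSupport
      hφ.continuous_gradient hφ.hasCompactSupport_gradient
    have iv := ((Lp.memLp v).locallyIntegrable one_le).integrable_smul_right_of_hasCompactSupport
      hφ.continuous_gradient hφ.hasCompactSupport_gradient
    have iG := ((Lp.memLp G).locallyIntegrable one_le).integrable_smul_left_of_hasCompactSupport
      hφ.1.continuous hφ.2.1
    have iH := ((Lp.memLp H).locallyIntegrable one_le).integrable_smul_left_of_hasCompactSupport
      hφ.1.continuous hφ.2.1
    have h1 : ∫ x in Ω, (u + v) x • ∇ φ x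
        = (∫ x in Ω, u x • ∇ φ x) + ∫ x in Ω, v x • ∇ φ x := by
      rw [← integral_add iu iv]
      apply integral_congr_ae
      filter_upwards [Lp.coeFn_add u v] with x hx
      rw [hx, Pi.add_apply, add_smul]
    have h2 : ∫ x in Ω, φ x • (G + H) x
        = (∫ x in Ω, φ x • G x) + ∫ x in Ω, φ x • H x := by
      rw [← integral_add iG iH]
      apply integral_congr_ae
      filter_upwards [Lp.coeFn_add G H] with x hx
      rw [hx, Pi.add_apply, smul_add]
    have e1 := hu φ hφ
    have e2 := hv φ hφ
    simp only [Prod.mk_add_mk] at e1 e2 ⊢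
    rw [h1, h2, e1, e2, neg_add]
  smul_mem' := by
    rintro c ⟨u, G⟩ hu φ hφ
    have h1 : ∫ x in Ω, (c • u) x • ∇ φ x = c • ∫ x in Ω, u x • ∇ φ x := by
      rw [← integral_smul]
      apply integral_congr_ae
      filter_upwards [Lp.coeFn_smul c u] with x hx
      rw [hx, Pi.smul_apply, smul_assoc]
    have h2 : ∫ x in Ω, φ x • (c • G) x = c • ∫ x in Ω, φ x • G x := by
      rw [← integral_smul]
      apply integral_congr_ae
      filter_upwards [Lp.coeFn_smul c G] with x hx
      rw [hx, Pi.smul_apply, smul_comm]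
    have e1 := hu φ hφ
    simp only [Prod.smul_mk] at e1 ⊢
    rw [h1, h2, e1, smul_neg]

variable {p Ω} in
/-- The weak gradient of an element of `W^{1,p}(Ω)`. -/
noncomputable def sobolevGrad (u : SobolevW p Ω) :
    EuclideanSpace ℝ (Fin n) → EuclideanSpace ℝ (Fin n) :=
  u.1.2

/-- `C_c^∞(Ω)` as a subspace of `W^{1,p}(Ω)`. -/
def sobolevTest : Submodule ℝ (SobolevW p Ω) where
  carrier := {w | ∃ φ : EuclideanSpace ℝ (Fin n) → ℝ, IsTestFunction Ω φ ∧
    w.1.1 =ᵐ[volume.restrict Ω] φ ∧ w.1.2 =ᵐ[volume.restrict Ω] ∇ φ}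
  zero_mem' := by
    refine ⟨fun _ => 0, ⟨contDiff_const, HasCompactSupport.zero, ?_⟩, ?_, ?_⟩
    · rw [show (fun _ : EuclideanSpace ℝ (Fin n) => (0 : ℝ)) = 0 from rfl, tsupport_zero]
      exact empty_subset Ω
    · exact Lp.coeFn_zero _ _ _
    · filter_upwards [Lp.coeFn_zero (EuclideanSpace ℝ (Fin n)) (ENNReal.ofReal p)
        (volume.restrict Ω)] with x hx
      have h0 : ∇ (fun _ : EuclideanSpace ℝ (Fin n) => (0 : ℝ)) x = 0 := by simp [gradient]
      rw [h0]
      exact hx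
  add_mem' := by
    rintro v w ⟨φ, hφ, hv, hv'⟩ ⟨ψ, hψ, hw, hw'⟩
    refine ⟨φ + ψ, ⟨hφ.1.add hψ.1, hφ.2.1.add hψ.2.1, ?_⟩, ?_, ?_⟩
    · exact (tsupport_add φ ψ).trans (union_subset hφ.2.2 hψ.2.2)
    · filter_upwards [Lp.coeFn_add v.1.1 w.1.1, hv, hw] with x h h1 h2
      rw [Pi.add_apply, ← h1, ← h2]
      exact h
    · filter_upwards [Lp.coeFn_add v.1.2 w.1.2, hv', hw'] with x h h1 h2
      rw [hφ.gradient_add hψ, ← h1, ← h2]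
      exact h
  smul_mem' := by
    rintro c v ⟨φ, hφ, hv, hv'⟩
    have e1 : (c • v).1.1 = c • v.1.1 := rfl
    have e2 : (c • v).1.2 = c • v.1.2 := rfl
    refine ⟨c • φ, hφ.smul c, ?_, ?_⟩
    · rw [e1]
      exact (Lp.coeFn_smul c v.1.1).trans (hv.fun_comp (fun y : ℝ => c • y))
    · rw [e2]
      filter_upwards [Lp.coeFn_smul c v.1.2, hv'] with x h h1
      rw [hφ.gradient_smul c, ← h1, h, Pi.smul_apply]

/-- `W_0^{1,p}(Ω)`: the closure of `C_c^∞(Ω)` in `W^{1,p}(Ω)`. -/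
noncomputable def SobolevW0 : Submodule ℝ (SobolevW p Ω) :=
  (sobolevTest p Ω).topologicalClosure

/-- The space of abstract boundary values `X = W^{1,p}(Ω) / W_0^{1,p}(Ω)`, with the quotient
topology. -/
abbrev BoundarySpace : Type :=
  SobolevW p Ω ⧸ SobolevW0 p Ω

variable {p Ω} in
/-- The boundary value of `u ∈ W^{1,p}(Ω)`, that is, its class in `X`. -/
noncomputable def sobolevTrace (u : SobolevW p Ω) : BoundarySpace p Ω :=
  (SobolevW0 p Ω).mkQ u

variable {p Ω} in
/-- The `p`-Dirichlet energy `E_σ(u) = ∫_Ω σ |∇u|^p dx`. -/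
noncomputable def dirichletEnergy (σ : EuclideanSpace ℝ (Fin n) → ℝ) (u : SobolevW p Ω) : ℝ :=
  ∫ x in Ω, σ x * ‖sobolevGrad u x‖ ^ p

variable {p Ω} in
/-- `u` is the weak solution of `div(σ |∇u|^{p-2} ∇u) = 0` in `Ω`, `u = f` on `∂Ω`: it minimizes
the energy `E_σ` among all elements of `W^{1,p}(Ω)` with boundary value `f`. -/
def IsSolution (σ : EuclideanSpace ℝ (Fin n) → ℝ) (f : BoundarySpace p Ω)
    (u : SobolevW p Ω) : Prop :=
  sobolevTrace u = f ∧ ∀ v : SobolevW p Ω, sobolevTrace v = f → dirichletEnergy σ u ≤ dirichletEnergy σ v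

variable {p Ω} in
/-- `Λ ∈ X'` is the Neumann data that belongs to the Dirichlet data `f`:
`(Λ, g) = ∫_Ω σ |∇u|^{p-2} ∇u · ∇v dx` for the solution `u` with boundary value `f`, for every
`g ∈ X` and every representative `v` of `g`. -/
def IsNeumannData (σ : EuclideanSpace ℝ (Fin n) → ℝ) (f : BoundarySpace p Ω)
    (Λ : StrongDual ℝ (BoundarySpace p Ω)) : Prop :=
  ∃ u : SobolevW p Ω, IsSolution σ f u ∧ ∀ v : SobolevW p Ω,
    Λ (sobolevTrace v) = ∫ x in Ω, σ x * ‖sobolevGrad u x‖ ^ (p - 2) *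
      inner ℝ (sobolevGrad u x) (sobolevGrad v x)

open Classical in
/-- The nonlinear Dirichlet-to-Neumann map `Λ_σ : X → X'`, which sends `f` to the unique element of
`X'` that is its Neumann data. (For bounded `Ω` and for `σ` measurable and bounded between positive
constants such an element always exists; the value `0` is a default for other `σ` and `Ω`.) -/
noncomputable def dnMap (σ : EuclideanSpace ℝ (Fin n) → ℝ) (f : BoundarySpace p Ω) :
    StrongDual ℝ (BoundarySpace p Ω) :=
  if h : ∃ Λ, IsNeumannData σ f Λ then h.choose else 0

end Sobolev

/-! The argument localizes energy at a boundary point. Pairing `Λ_σ f` with `f` gives the minimal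
`σ`-energy for the boundary value `f` (`exists_isSolution_dnMap_eq`), so equal maps give equal
minimal energies for every `f`. Only this scalar information is used, and uniqueness of minimizers
is not needed.

Suppose `σ₁ x₀ < a < b < σ₂ x₀`, and let `B` be a ball around `x₀` with `σ₁ ≤ a` and `b ≤ σ₂` on `Ω
∩ B`. Take `w` to be `p`-harmonic for the constant weight 1. As a competitor, `w` bounds the minimal
`σ₁`-energy above by `a ∫ |∇w|^p` plus a multiple of the energy of `w` off `B`. Young's inequality
and the weak equation for `w` bound the minimal `σ₂`-energy below by `b ∫ |∇w|^p` minus such a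
multiple. Hence `(b - a) ∫ |∇w|^p ≤ Q ∫_{Ω∖B} |∇w|^p`, with `Q` independent of `w`
(`mul_integral_le_of_dnMap_eq`).

This fails once `w` concentrates in `B`. Wolff's solutions (`exists_wolffSolution`) have gradients
comparable to `τ |v| e^{-τ⟨v, x - x₀⟩}`, with constants independent of `τ`. Strict convexity gives a
normal `v` with `⟨v, x - x₀⟩ > 0` on the rest of `closure Ω`, hence `⟨v, x - x₀⟩ ≥ d > 0` off `B`. A
subset of `Ω` of positive measure has `⟨v, x - x₀⟩ < d/2`, and `τ → ∞` gives a contradiction.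

What remains is that `Λ_σ` is not the default value: the direct method gives minimizers, and the
Euler–Lagrange equation lets the first variation descend to `X`. -/

/-! ### Pointwise inequalities for `|x|^p` and its flux. -/

section Pointwise

/-- Young's inequality with exponents `p/(p-1)` and `p`, applied to `a^(p-1)` and `b`. The constants
are sharp (equality at `a = b`), so the tangent inequality for `|x|^p` follows from it. -/
theorem mul_rpow_sub_one_mul_le {p : ℝ} (hp : 1 < p) {a b : ℝ} (ha : 0 ≤ a) (hb : 0 ≤ b) :
    p * (a ^ (p - 1) * b) ≤ (p - 1) * a ^ p + b ^ p := by
  have hc : p.HolderConjugate (p / (p - 1)) := Real.HolderConjugate.conjExponent hp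
  have h1 : 0 < p - 1 := by linarith
  have h := Real.young_inequality_of_nonneg (Real.rpow_nonneg ha (p - 1)) hb hc.symm
  rw [← Real.rpow_mul ha, show (p - 1) * (p / (p - 1)) = p by field_simp] at h
  have h2 := mul_le_mul_of_nonneg_left h (by linarith : 0 ≤ p)
  calc _ ≤ _ := h2
    _ = _ := by field_simp

theorem norm_rpow_sub_one_mul_norm {E : Type*} [NormedAddCommGroup E] {p : ℝ} (hp : 1 < p) (x : E) :
    ‖x‖ ^ (p - 1) * ‖x‖ = ‖x‖ ^ p := by
  rw [← Real.rpow_add_one' (norm_nonneg x) (by linarith)]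
  ring_nf

theorem norm_rpow_sub_one_mul_norm_le {E : Type*} [NormedAddCommGroup E] {p : ℝ} (hp : 1 < p) (x y : E) :
    ‖x‖ ^ (p - 1) * ‖y‖ ≤ ‖x‖ ^ p + ‖y‖ ^ p := by
  have h := mul_rpow_sub_one_mul_le hp (norm_nonneg x) (norm_nonneg y)
  have h1 : 0 ≤ ‖x‖ ^ p := by positivity
  have h2 : 0 ≤ ‖y‖ ^ p := by positivity
  nlinarith

variable {E : Type*} [NormedAddCommGroup E] [InnerProductSpace ℝ E]

/-- The field `|x|^{p-2} x`. -/
noncomputable def pFlux (p : ℝ) (x : E) : E := ‖x‖ ^ (p - 2) • x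

theorem norm_pFlux {p : ℝ} (hp : 1 < p) (x : E) : ‖pFlux p x‖ = ‖x‖ ^ (p - 1) := by
  rw [pFlux, norm_smul, Real.norm_of_nonneg (by positivity),
    ← Real.rpow_add_one' (norm_nonneg x) (by linarith)]
  ring_nf

theorem inner_pFlux_self {p : ℝ} (hp : 1 < p) (x : E) : inner ℝ (pFlux p x) x = ‖x‖ ^ p := by
  rw [pFlux, real_inner_smul_left, real_inner_self_eq_norm_sq, pow_two, ← mul_assoc,
    ← Real.rpow_add_one' (norm_nonneg x) (by linarith), ← norm_rpow_sub_one_mul_norm hp]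
  ring_nf

/-- For `p < 2` the scalar factor is singular at the origin; continuity there comes from the norm
being `‖x‖^(p-1)` with `p - 1 > 0`. -/
theorem continuous_pFlux {p : ℝ} (hp : 1 < p) : Continuous (pFlux p : E → E) := by
  rw [continuous_iff_continuousAt]
  intro x
  by_cases hx : x = 0
  · subst hx
    have h : Filter.Tendsto (fun x : E => ‖x‖ ^ (p - 1)) (nhds 0) (nhds 0) := by
      have : ContinuousAt (fun x : E => ‖x‖ ^ (p - 1)) 0 :=
        continuousAt_id.norm.rpow_const (.inr (by linarith))
      simpa [ContinuousAt, Real.zero_rpow (by linarith : p - 1 ≠ 0)] using this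
    have h0 : pFlux p (0 : E) = 0 := by simp [pFlux]
    rw [ContinuousAt, h0, tendsto_zero_iff_norm_tendsto_zero]
    simpa only [norm_pFlux hp] using h
  · exact (continuousAt_id.norm.rpow_const (.inl (by simpa using hx))).smul continuousAt_id

theorem abs_inner_pFlux_le {p : ℝ} (hp : 1 < p) (x y : E) :
    |inner ℝ (pFlux p x) y| ≤ ‖x‖ ^ (p - 1) * ‖y‖ :=
  (abs_real_inner_le_norm _ _).trans_eq (by rw [norm_pFlux hp])

/-- Convexity in tangent form: `p · pFlux p x` is the gradient of `‖·‖^p` at `x`. It follows from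
Cauchy–Schwarz and Young. -/
theorem norm_rpow_add_inner_pFlux_le {p : ℝ} (hp : 1 < p) (x y : E) :
    ‖x‖ ^ p + p * inner ℝ (pFlux p x) (y - x) ≤ ‖y‖ ^ p := by
  rw [inner_sub_right, inner_pFlux_self hp]
  have h1 := (abs_le.1 (abs_inner_pFlux_le hp x y)).2
  have h2 := mul_rpow_sub_one_mul_le hp (norm_nonneg x) (norm_nonneg y)
  nlinarith

/-- A weighted Young inequality for the pairing of `|x|^{p-2} x` with `y`. -/
theorem mul_inner_pFlux_le {p : ℝ} (hp : 1 < p) {b s : ℝ} (hb : 0 < b) (hs : 0 < s) (x y : E) :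
    p * (b * inner ℝ (pFlux p x) y) ≤
      (p - 1) * (s * (b / s) ^ (p / (p - 1))) * ‖x‖ ^ p + s * ‖y‖ ^ p := by
  have h1 : 0 < p - 1 := by linarith
  -- With `k^(p-1) = b/s`, Young's inequality for `k‖x‖` and `‖y‖`, multiplied by `s`, has
  -- coefficient `b` on the mixed term and `s` on `‖y‖^p`.
  set k : ℝ := (b / s) ^ (1 / (p - 1)) with hk
  have hk0 : 0 ≤ k := by positivity
  have hk1 : k ^ (p - 1) = b / s := by
    rw [hk, ← Real.rpow_mul (by positivity), show 1 / (p - 1) * (p - 1) = 1 by field_simp,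
      Real.rpow_one]
  have hk2 : k ^ p = (b / s) ^ (p / (p - 1)) := by
    rw [hk, ← Real.rpow_mul (by positivity)]
    ring_nf
  have h := mul_rpow_sub_one_mul_le hp (a := k * ‖x‖) (by positivity) (norm_nonneg y)
  rw [Real.mul_rpow hk0 (norm_nonneg x), Real.mul_rpow hk0 (norm_nonneg x), hk1, hk2] at h
  have h2 := (abs_le.1 (abs_inner_pFlux_le hp x y)).2
  calc p * (b * inner ℝ (pFlux p x) y) ≤ p * (b * (‖x‖ ^ (p - 1) * ‖y‖)) := by gcongr
    _ = s * (p * (b / s * ‖x‖ ^ (p - 1) * ‖y‖)) := by field_simp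
    _ ≤ s * ((p - 1) * ((b / s) ^ (p / (p - 1)) * ‖x‖ ^ p) + ‖y‖ ^ p) := by gcongr
    _ = _ := by ring

theorem norm_midpoint_rpow_le {p : ℝ} (hp : 1 < p) (a b : E) :
    ‖(1 / 2 : ℝ) • (a + b)‖ ^ p ≤ (‖a‖ ^ p + ‖b‖ ^ p) / 2 := by
  have h1 := norm_rpow_add_inner_pFlux_le hp ((1 / 2 : ℝ) • (a + b)) a
  have h2 := norm_rpow_add_inner_pFlux_le hp ((1 / 2 : ℝ) • (a + b)) b
  have h3 : inner ℝ (pFlux p ((1 / 2 : ℝ) • (a + b))) (a - (1 / 2 : ℝ) • (a + b)) +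
      inner ℝ (pFlux p ((1 / 2 : ℝ) • (a + b))) (b - (1 / 2 : ℝ) • (a + b)) = 0 := by
    rw [← inner_add_right]
    convert inner_zero_right _
    module
  nlinarith

/-- Strict convexity of `t^p` forces equal norms; then the triangle inequality is an equality, and
strict convexity of the Hilbert norm gives `a = b`. -/
theorem eq_of_norm_midpoint_rpow_eq {p : ℝ} (hp : 1 < p) {a b : E}
    (h : (‖a‖ ^ p + ‖b‖ ^ p) / 2 ≤ ‖(1 / 2 : ℝ) • (a + b)‖ ^ p) : a = b := by
  have hn : ‖(1 / 2 : ℝ) • (a + b)‖ = (1 / 2) * ‖a + b‖ := by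
    rw [norm_smul]; norm_num
  have h1 : ‖(1 / 2 : ℝ) • (a + b)‖ ≤ (1 / 2) * ‖a‖ + (1 / 2) * ‖b‖ := by
    rw [hn]; linarith [norm_add_le a b]
  have h2 : ‖(1 / 2 : ℝ) • (a + b)‖ ^ p ≤ ((1 / 2) * ‖a‖ + (1 / 2) * ‖b‖) ^ p := by gcongr
  have hab : ‖a‖ = ‖b‖ := by
    by_contra hne
    have := (strictConvexOn_rpow hp).2 (norm_nonneg a) (norm_nonneg b) hne
      (by norm_num : (0 : ℝ) < 1 / 2) (by norm_num : (0 : ℝ) < 1 / 2) (by norm_num)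
    simp only [smul_eq_mul] at this
    linarith
  refine eq_of_norm_eq_of_norm_add_eq hab (le_antisymm (norm_add_le a b) ?_)
  have h3 : ‖b‖ ^ p ≤ (1 / 2 * ‖a + b‖) ^ p := by rw [← hn]; rw [hab] at h; linarith
  have h4 := (Real.rpow_le_rpow_iff (norm_nonneg b) (by positivity) (by linarith)).1 h3
  linarith

/-- Uniform convexity of `|x|^p`. -/
theorem exists_norm_sub_rpow_le [FiniteDimensional ℝ E] {p : ℝ} (hp : 1 < p) {ε : ℝ}
    (hε : 0 < ε) : ∃ C : ℝ, 0 ≤ C ∧ ∀ a b : E, ‖a - b‖ ^ p ≤ ε * (‖a‖ ^ p + ‖b‖ ^ p) +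
      C * ((‖a‖ ^ p + ‖b‖ ^ p) / 2 - ‖(1 / 2 : ℝ) • (a + b)‖ ^ p) := by
  have hp0 : 0 < p := by linarith
  have hc : ∀ f : E × E → E, Continuous f → Continuous fun z => ‖f z‖ ^ p := fun f hf =>
    hf.norm.rpow_const fun _ => .inr hp0.le
  let N : E × E → ℝ := fun z => ‖z.1‖ ^ p + ‖z.2‖ ^ p
  let D : E × E → ℝ := fun z => ‖z.1 - z.2‖ ^ p
  let F : E × E → ℝ := fun z => N z / 2 - ‖(1 / 2 : ℝ) • (z.1 + z.2)‖ ^ p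
  have hN : Continuous N := (hc _ continuous_fst).add (hc _ continuous_snd)
  have hD : Continuous D := hc _ (by fun_prop)
  have hF : Continuous F := (hN.div_const 2).sub (hc _ (by fun_prop))
  have hF0 : ∀ z, 0 ≤ F z := fun z => sub_nonneg.2 (norm_midpoint_rpow_le hp z.1 z.2)
  -- On this compact set the convexity defect `F` is positive, so `D / F` is bounded. Where `D < ε`
  -- the `ε` term suffices, and homogeneity of degree `p` removes the normalization `N = 1`.
  let K : Set (E × E) := {z | N z = 1 ∧ ε ≤ D z}
  have hKc : IsCompact K := by
    refine Metric.isCompact_of_isClosed_isBounded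
      ((isClosed_eq hN continuous_const).inter (isClosed_le continuous_const hD)) ?_
    refine (Metric.isBounded_iff_subset_closedBall 0).2 ⟨1, fun z hz => ?_⟩
    have h1 : ‖z.1‖ ^ p + ‖z.2‖ ^ p = 1 := hz.1
    have h2 : 0 ≤ ‖z.1‖ ^ p := by positivity
    have h3 : 0 ≤ ‖z.2‖ ^ p := by positivity
    have key : ∀ t : ℝ, 0 ≤ t → t ^ p ≤ 1 → t ≤ 1 := fun t ht h => by
      by_contra hlt
      exact absurd (Real.one_lt_rpow (not_le.1 hlt) hp0) (not_lt.2 h)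
    rw [mem_closedBall_zero_iff, Prod.norm_def]
    exact max_le (key _ (norm_nonneg _) (by linarith)) (key _ (norm_nonneg _) (by linarith))
  have hFpos : ∀ z ∈ K, 0 < F z := by
    intro z hz
    by_contra hlt
    have : z.1 = z.2 := eq_of_norm_midpoint_rpow_eq hp (by
      have : F z ≤ 0 := not_lt.1 hlt
      simp only [F, N] at this
      linarith)
    have h2 : ε ≤ D z := hz.2
    simp only [D, this, sub_self, norm_zero, Real.zero_rpow hp0.ne'] at h2
    linarith
  obtain ⟨C, hC⟩ : ∃ C, ∀ z ∈ K, D z / F z ≤ C := by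
    have := hKc.bddAbove_image (f := fun z => D z / F z)
      (hD.continuousOn.div hF.continuousOn fun z hz => (hFpos z hz).ne')
    obtain ⟨C, hC⟩ := this
    exact ⟨C, fun z hz => hC ⟨z, hz, rfl⟩⟩
  have hone : ∀ z, N z = 1 → D z ≤ ε + max C 0 * F z := by
    intro z hz
    by_cases h : ε ≤ D z
    · have h1 := (div_le_iff₀ (hFpos z ⟨hz, h⟩)).1 (hC z ⟨hz, h⟩)
      have h2 : C * F z ≤ max C 0 * F z := mul_le_mul_of_nonneg_right (le_max_left _ _) (hF0 z)
      linarith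
    · have := mul_nonneg (le_max_right C 0) (hF0 z)
      linarith
  refine ⟨max C 0, le_max_right _ _, fun a b => ?_⟩
  change D (a, b) ≤ ε * N (a, b) + max C 0 * F (a, b)
  have hN0 : 0 ≤ N (a, b) := by positivity
  rcases hN0.eq_or_lt with h0 | hpos
  · have h1 : 0 ≤ ‖a‖ ^ p := by positivity
    have h2 : 0 ≤ ‖b‖ ^ p := by positivity
    have h3 : 0 = ‖a‖ ^ p + ‖b‖ ^ p := h0
    have ha : a = 0 := by
      have : ‖a‖ ^ p = 0 := by linarith
      simpa [Real.rpow_eq_zero (norm_nonneg a) hp0.ne'] using this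
    have hb : b = 0 := by
      have : ‖b‖ ^ p = 0 := by linarith
      simpa [Real.rpow_eq_zero (norm_nonneg b) hp0.ne'] using this
    simp [D, F, N, ha, hb, Real.zero_rpow hp0.ne']
  · set t : ℝ := (N (a, b)) ^ (-(1 / p)) with ht
    have ht0 : 0 < t := by positivity
    have htp : t ^ p = (N (a, b))⁻¹ := by
      rw [ht, ← Real.rpow_mul hN0, show -(1 / p) * p = -1 by field_simp, Real.rpow_neg_one]
    have hs : ∀ x : E, ‖t • x‖ ^ p = (N (a, b))⁻¹ * ‖x‖ ^ p := fun x => by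
      rw [norm_smul, Real.norm_of_nonneg ht0.le, Real.mul_rpow ht0.le (norm_nonneg x), htp]
    have hNs : N (t • a, t • b) = 1 := by
      change ‖t • a‖ ^ p + ‖t • b‖ ^ p = 1
      rw [hs, hs, ← mul_add]
      exact inv_mul_cancel₀ hpos.ne'
    have h := hone _ hNs
    have hDs : D (t • a, t • b) = (N (a, b))⁻¹ * D (a, b) := by
      simp only [D]
      rw [← smul_sub, hs]
    have hFs : F (t • a, t • b) = (N (a, b))⁻¹ * F (a, b) := by
      simp only [F]
      rw [hNs, ← smul_add, smul_comm, hs, mul_sub, mul_div_assoc', inv_mul_cancel₀ hpos.ne']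
    rw [hDs, hFs] at h
    have h2 := mul_le_mul_of_nonneg_left h hN0
    calc D (a, b) = N (a, b) * ((N (a, b))⁻¹ * D (a, b)) := by field_simp
      _ ≤ _ := h2
      _ = _ := by field_simp

end Pointwise

/-! ### The weighted energy on `L^p`: first variation, uniform convexity, minimizers. -/

section WeightedLp

/-- The weight `σ` is measurable and bounded between the positive constants `m` and `M`. -/
structure IsBoundedWeight {α : Type*} [MeasurableSpace α] (μ : Measure α) (σ : α → ℝ)
    (m M : ℝ) : Prop where
  aestronglyMeasurable : AEStronglyMeasurable σ μ
  pos : 0 < m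
  lower : ∀ᵐ x ∂μ, m ≤ σ x
  upper : ∀ᵐ x ∂μ, σ x ≤ M

namespace IsBoundedWeight

variable {α : Type*} [MeasurableSpace α] {μ : Measure α} {σ : α → ℝ} {m M : ℝ}

theorem nonneg (h : IsBoundedWeight μ σ m M) : ∀ᵐ x ∂μ, 0 ≤ σ x :=
  h.lower.mono fun _ hx => h.pos.le.trans hx

theorem norm_le (h : IsBoundedWeight μ σ m M) : ∀ᵐ x ∂μ, ‖σ x‖ ≤ M := by
  filter_upwards [h.nonneg, h.upper] with x h1 h2
  rwa [Real.norm_of_nonneg h1]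

theorem integrable_mul (h : IsBoundedWeight μ σ m M) {f : α → ℝ} (hf : Integrable f μ) :
    Integrable (fun x => σ x * f x) μ :=
  hf.bdd_mul h.aestronglyMeasurable h.norm_le

end IsBoundedWeight

variable {α : Type*} [MeasurableSpace α] {μ : Measure α} {p : ℝ}

theorem mul_norm_rpow_mul_inner {E : Type*} [NormedAddCommGroup E] [InnerProductSpace ℝ E]
    (s : ℝ) (x y : E) :
    s * ‖x‖ ^ (p - 2) * inner ℝ x y = s * inner ℝ (pFlux p x) y := by
  rw [pFlux, real_inner_smul_left, mul_assoc]

/-- The weighted energy `∫ σ |U|^p`. -/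
noncomputable def lpEnergy {E : Type*} [NormedAddCommGroup E] (σ : α → ℝ)
    (U : Lp E (ENNReal.ofReal p) μ) : ℝ :=
  ∫ x, σ x * ‖U x‖ ^ p ∂μ

theorem IsBoundedWeight.lpEnergy_nonneg {E : Type*} [NormedAddCommGroup E] {σ : α → ℝ} {m M : ℝ}
    (h : IsBoundedWeight μ σ m M) (U : Lp E (ENNReal.ofReal p) μ) : 0 ≤ lpEnergy σ U :=
  integral_nonneg_of_ae <| by
    filter_upwards [h.nonneg] with x hx
    exact mul_nonneg hx (by positivity)

variable [hp : Fact (1 < p)]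

section Normed

variable {E : Type*} [NormedAddCommGroup E]

theorem integrable_norm_rpow_of_memLp {f : α → E} (hf : MemLp f (ENNReal.ofReal p) μ) :
    Integrable (fun x => ‖f x‖ ^ p) μ := by
  have hp0 : 0 < p := by linarith [hp.out]
  simpa [ENNReal.toReal_ofReal hp0.le] using
    hf.integrable_norm_rpow (by simpa using hp0) ENNReal.ofReal_ne_top

theorem lp_norm_rpow_eq_integral (U : Lp E (ENNReal.ofReal p) μ) :
    ‖U‖ ^ p = ∫ x, ‖U x‖ ^ p ∂μ := by
  have hp0 : 0 < p := by linarith [hp.out]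
  have h0 : 0 ≤ ∫ x, ‖U x‖ ^ p ∂μ := integral_nonneg fun x => by positivity
  rw [Lp.norm_def, (Lp.memLp U).eLpNorm_eq_integral_rpow_norm (by simpa using hp0)
    ENNReal.ofReal_ne_top, ENNReal.toReal_ofReal hp0.le, ENNReal.toReal_ofReal (by positivity),
    ← Real.rpow_mul h0, inv_mul_cancel₀ hp0.ne', Real.rpow_one]

variable {σ : α → ℝ} {m M : ℝ}

theorem IsBoundedWeight.integrable_energy (h : IsBoundedWeight μ σ m M)
    (U : Lp E (ENNReal.ofReal p) μ) : Integrable (fun x => σ x * ‖U x‖ ^ p) μ :=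
  h.integrable_mul (integrable_norm_rpow_of_memLp (Lp.memLp U))

end Normed

variable {E : Type*} [NormedAddCommGroup E] [InnerProductSpace ℝ E]
  {σ : α → ℝ} {m M : ℝ}

/-- Since `(p-1) · p/(p-1) = p`, the conjugate power of the flux is dominated by a multiple of
`‖U‖^p`. -/
theorem IsBoundedWeight.memLp_flux (h : IsBoundedWeight μ σ m M)
    (U : Lp E (ENNReal.ofReal p) μ) :
    MemLp (fun x => σ x • pFlux p (U x)) (ENNReal.ofReal (p / (p - 1))) μ := by
  have hp1 := hp.out
  have hq : 0 < p / (p - 1) := div_pos (by linarith) (by linarith)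
  have hm : AEStronglyMeasurable (fun x => σ x • pFlux p (U x)) μ :=
    h.aestronglyMeasurable.smul
      ((continuous_pFlux hp1).comp_aestronglyMeasurable (Lp.aestronglyMeasurable U))
  rw [← integrable_norm_rpow_iff hm (by simpa using hq) ENNReal.ofReal_ne_top,
    ENNReal.toReal_ofReal hq.le]
  refine ((integrable_norm_rpow_of_memLp (Lp.memLp U)).const_mul (M ^ (p / (p - 1)))).mono'
    (hm.norm.aemeasurable.pow_const _).aestronglyMeasurable ?_
  filter_upwards [h.norm_le] with x hx
  rw [norm_smul, norm_pFlux hp1, Real.mul_rpow (norm_nonneg _) (by positivity),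
    ← Real.rpow_mul (norm_nonneg _), mul_div_cancel₀ p (by linarith : p - 1 ≠ 0),
    Real.norm_of_nonneg (by positivity)]
  gcongr

theorem IsBoundedWeight.integrable_inner_flux (h : IsBoundedWeight μ σ m M)
    (U V : Lp E (ENNReal.ofReal p) μ) :
    Integrable (fun x => σ x * inner ℝ (pFlux p (U x)) (V x)) μ := by
  refine h.integrable_mul (((integrable_norm_rpow_of_memLp (Lp.memLp U)).add
    (integrable_norm_rpow_of_memLp (Lp.memLp V))).mono'
    (((continuous_pFlux hp.out).comp_aestronglyMeasurable (Lp.aestronglyMeasurable U)).inner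
      (Lp.aestronglyMeasurable V)) (ae_of_all _ fun x => ?_))
  exact (abs_inner_pFlux_le hp.out _ _).trans (norm_rpow_sub_one_mul_norm_le hp.out _ _)

/-- The first variation of the energy at `U` is a continuous functional on `L^p`. -/
theorem IsBoundedWeight.exists_firstVariation [CompleteSpace E] (h : IsBoundedWeight μ σ m M)
    (U : Lp E (ENNReal.ofReal p) μ) : ∃ L : StrongDual ℝ (Lp E (ENNReal.ofReal p) μ),
      ∀ V, L V = ∫ x, σ x * inner ℝ (pFlux p (U x)) (V x) ∂μ := by
  have hp1 := hp.out
  have hc : p.HolderConjugate (p / (p - 1)) := Real.HolderConjugate.conjExponent hp1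
  have : (ENNReal.ofReal (p / (p - 1))).HolderConjugate (ENNReal.ofReal p) := hc.symm.ennrealOfReal
  have : Fact (1 ≤ ENNReal.ofReal (p / (p - 1))) := ⟨by simpa using hc.symm.lt.le⟩
  refine ⟨ContinuousLinearMap.lpPairing μ _ _ (innerSL ℝ) ((h.memLp_flux U).toLp _), fun V => ?_⟩
  rw [ContinuousLinearMap.lpPairing_eq_integral]
  apply integral_congr_ae
  filter_upwards [(h.memLp_flux U).coeFn_toLp] with x hx
  rw [hx, innerSL_apply_apply, real_inner_smul_left]

theorem IsBoundedWeight.lpEnergy_add_le (h : IsBoundedWeight μ σ m M)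
    (U V : Lp E (ENNReal.ofReal p) μ) :
    lpEnergy σ U + p * ∫ x, σ x * inner ℝ (pFlux p (U x)) ((V - U) x) ∂μ ≤ lpEnergy σ V := by
  rw [lpEnergy, lpEnergy, ← integral_const_mul,
    ← integral_add (h.integrable_energy U) ((h.integrable_inner_flux U (V - U)).const_mul p)]
  refine integral_mono_ae ((h.integrable_energy U).add
    ((h.integrable_inner_flux U (V - U)).const_mul p)) (h.integrable_energy V) ?_
  filter_upwards [h.nonneg, Lp.coeFn_sub V U] with x hx hs
  rw [hs, Pi.sub_apply]
  calc σ x * ‖U x‖ ^ p + p * (σ x * inner ℝ (pFlux p (U x)) (V x - U x))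
      = σ x * (‖U x‖ ^ p + p * inner ℝ (pFlux p (U x)) (V x - U x)) := by ring
    _ ≤ σ x * ‖V x‖ ^ p :=
      mul_le_mul_of_nonneg_left (norm_rpow_add_inner_pFlux_le hp.out _ _) hx

/-- A bound uniform in `|t| ≤ 1`, which is the domination needed to differentiate the energy under
the integral. -/
theorem norm_add_smul_rpow_sub_one_mul_le {t : ℝ} (ht : |t| ≤ 1) (x y : E) :
    ‖x + t • y‖ ^ (p - 1) * ‖y‖ ≤ (‖x‖ + ‖y‖) ^ p := by
  have hp1 := hp.out
  have hle : ‖x + t • y‖ ≤ ‖x‖ + ‖y‖ := by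
    refine (norm_add_le _ _).trans ?_
    rw [norm_smul, Real.norm_eq_abs]
    have := mul_le_mul_of_nonneg_right ht (norm_nonneg y)
    linarith
  have hn : 0 ≤ ‖x‖ + ‖y‖ := by positivity
  calc ‖x + t • y‖ ^ (p - 1) * ‖y‖ ≤ (‖x‖ + ‖y‖) ^ (p - 1) * (‖x‖ + ‖y‖) := by
        gcongr
        linarith [norm_nonneg x]
    _ = (‖x‖ + ‖y‖) ^ p := by
      rw [← Real.rpow_add_one' hn (by linarith)]
      ring_nf

theorem hasDerivAt_mul_norm_add_smul_rpow (s t : ℝ) (x y : E) :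
    HasDerivAt (fun t : ℝ => s * ‖x + t • y‖ ^ p)
      (s * (p * inner ℝ (pFlux p (x + t • y)) y)) t := by
  have h1 : HasDerivAt (fun t : ℝ => x + t • y) y t := by
    simpa using ((hasDerivAt_id t).smul_const y).const_add x
  refine (((hasFDerivAt_norm_rpow (x + t • y) hp.out).comp_hasDerivAt t h1).const_mul s).congr_deriv
    ?_
  rw [pFlux, real_inner_smul_left, smul_apply, innerSL_apply_apply, smul_eq_mul,
    mul_assoc p]

theorem IsBoundedWeight.hasDerivAt_lpEnergy (h : IsBoundedWeight μ σ m M)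
    (U V : Lp E (ENNReal.ofReal p) μ) :
    HasDerivAt (fun t : ℝ => lpEnergy σ (U + t • V))
      (p * ∫ x, σ x * inner ℝ (pFlux p (U x)) (V x) ∂μ) 0 := by
  have hp1 := hp.out
  have hp0 : 0 < p := by linarith
  have hF : (fun t : ℝ => lpEnergy σ (U + t • V)) =
      fun t => ∫ x, σ x * ‖U x + t • V x‖ ^ p ∂μ := by
    funext t
    apply integral_congr_ae
    filter_upwards [Lp.coeFn_add U (t • V), Lp.coeFn_smul t V] with x h1 h2
    rw [h1, Pi.add_apply, h2, Pi.smul_apply]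
  have hUm := Lp.aestronglyMeasurable U
  have hVm := Lp.aestronglyMeasurable V
  have hmem : MemLp (fun x => ‖U x‖ + ‖V x‖) (ENNReal.ofReal p) μ :=
    (Lp.memLp U).norm.add (Lp.memLp V).norm
  have hFm : ∀ t : ℝ, AEStronglyMeasurable (fun x => σ x * ‖U x + t • V x‖ ^ p) μ := fun t =>
    h.aestronglyMeasurable.mul
      ((hUm.add (hVm.const_smul t)).norm.aemeasurable.pow_const p).aestronglyMeasurable
  have hFi : Integrable (fun x => σ x * ‖U x + (0 : ℝ) • V x‖ ^ p) μ := by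
    simpa only [zero_smul, add_zero] using h.integrable_energy U
  have hF'm : AEStronglyMeasurable
      (fun x => σ x * (p * inner ℝ (pFlux p (U x + (0 : ℝ) • V x)) (V x))) μ := by
    simp only [zero_smul, add_zero]
    exact h.aestronglyMeasurable.mul (aestronglyMeasurable_const.mul
      (((continuous_pFlux hp1).comp_aestronglyMeasurable hUm).inner hVm))
  have hb : ∀ᵐ x ∂μ, ∀ t ∈ Metric.ball (0 : ℝ) 1,
      ‖σ x * (p * inner ℝ (pFlux p (U x + t • V x)) (V x))‖ ≤
        M * (p * ‖‖U x‖ + ‖V x‖‖ ^ p) := by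
    filter_upwards [h.norm_le] with x hx t ht
    have ht1 : |t| ≤ 1 := by simpa using (mem_ball_zero_iff.1 ht).le
    have hn : 0 ≤ ‖U x‖ + ‖V x‖ := by positivity
    have hM : 0 ≤ M := (norm_nonneg _).trans hx
    have h3 : ‖inner ℝ (pFlux p (U x + t • V x)) (V x)‖ ≤ (‖U x‖ + ‖V x‖) ^ p :=
      (abs_inner_pFlux_le hp1 _ _).trans (norm_add_smul_rpow_sub_one_mul_le ht1 _ _)
    rw [norm_mul, norm_mul, Real.norm_of_nonneg hp0.le, Real.norm_of_nonneg hn]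
    gcongr
  have key := hasDerivAt_integral_of_dominated_loc_of_deriv_le (Metric.ball_mem_nhds 0 one_pos)
    (Filter.Eventually.of_forall hFm) hFi hF'm hb
    (((integrable_norm_rpow_of_memLp hmem).const_mul p).const_mul M)
    (ae_of_all _ fun x t _ => hasDerivAt_mul_norm_add_smul_rpow (σ x) t (U x) (V x))
  rw [hF]
  refine key.2.congr_deriv ?_
  rw [← integral_const_mul]
  simp only [zero_smul, add_zero]
  exact integral_congr_ae (ae_of_all _ fun x => by ring)

theorem IsBoundedWeight.exists_norm_sub_rpow_le [FiniteDimensional ℝ E]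
    (h : IsBoundedWeight μ σ m M) {ε : ℝ} (hε : 0 < ε) : ∃ C : ℝ, 0 ≤ C ∧
      ∀ U V : Lp E (ENNReal.ofReal p) μ, m * ‖U - V‖ ^ p ≤ ε * (lpEnergy σ U + lpEnergy σ V) +
        C * ((lpEnergy σ U + lpEnergy σ V) / 2 - lpEnergy σ ((1 / 2 : ℝ) • (U + V))) := by
  obtain ⟨C, hC0, hC⟩ := _root_.exists_norm_sub_rpow_le (E := E) hp.out hε
  refine ⟨C, hC0, fun U V => ?_⟩
  have iU := h.integrable_energy U
  have iV := h.integrable_energy V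
  have iW := h.integrable_energy ((1 / 2 : ℝ) • (U + V))
  have iUV : Integrable (fun x => σ x * ‖U x‖ ^ p + σ x * ‖V x‖ ^ p) μ := iU.add iV
  have iD : Integrable (fun x => (σ x * ‖U x‖ ^ p + σ x * ‖V x‖ ^ p) / 2 -
      σ x * ‖((1 / 2 : ℝ) • (U + V)) x‖ ^ p) μ := (iUV.div_const 2).sub iW
  rw [lp_norm_rpow_eq_integral, ← integral_const_mul]
  have hR : ε * (lpEnergy σ U + lpEnergy σ V) +
      C * ((lpEnergy σ U + lpEnergy σ V) / 2 - lpEnergy σ ((1 / 2 : ℝ) • (U + V))) =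
      ∫ x, ε * (σ x * ‖U x‖ ^ p + σ x * ‖V x‖ ^ p) + C * ((σ x * ‖U x‖ ^ p + σ x * ‖V x‖ ^ p) / 2
        - σ x * ‖((1 / 2 : ℝ) • (U + V)) x‖ ^ p) ∂μ := by
    rw [integral_add (iUV.const_mul ε) (iD.const_mul C),
      integral_const_mul, integral_const_mul, integral_sub (iUV.div_const 2) iW,
      integral_div, integral_add iU iV]
    rfl
  rw [hR]
  refine integral_mono_ae ((integrable_norm_rpow_of_memLp (Lp.memLp (U - V))).const_mul m)
    ((iUV.const_mul ε).add (iD.const_mul C)) ?_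
  filter_upwards [h.lower, Lp.coeFn_sub U V, Lp.coeFn_add U V,
    Lp.coeFn_smul (1 / 2 : ℝ) (U + V)] with x h1 h2 h3 h4
  rw [h4, h2, Pi.smul_apply, h3, Pi.sub_apply, Pi.add_apply]
  calc m * ‖U x - V x‖ ^ p ≤ σ x * ‖U x - V x‖ ^ p := by gcongr
    _ ≤ σ x * (ε * (‖U x‖ ^ p + ‖V x‖ ^ p) +
      C * ((‖U x‖ ^ p + ‖V x‖ ^ p) / 2 - ‖(1 / 2 : ℝ) • (U x + V x)‖ ^ p)) :=
      mul_le_mul_of_nonneg_left (hC _ _) (h.pos.le.trans h1)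
    _ = _ := by ring

/-- The weighted energy attains its minimum on every nonempty closed convex set. -/
theorem IsBoundedWeight.exists_forall_lpEnergy_le [FiniteDimensional ℝ E]
    (h : IsBoundedWeight μ σ m M) {S : Set (Lp E (ENNReal.ofReal p) μ)} (hne : S.Nonempty)
    (hcl : IsClosed S) (hcv : Convex ℝ S) :
    ∃ U ∈ S, ∀ V ∈ S, lpEnergy σ U ≤ lpEnergy σ V := by
  have hp0 : 0 < p := by linarith [hp.out]
  have hbdd : BddBelow (lpEnergy σ '' S) :=
    ⟨0, by rintro _ ⟨U, -, rfl⟩; exact h.lpEnergy_nonneg U⟩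
  obtain ⟨e, -, he, heS⟩ := exists_seq_tendsto_sInf (hne.image (lpEnergy σ)) hbdd
  set I := sInf (lpEnergy σ '' S) with hI
  have hIle : ∀ V ∈ S, I ≤ lpEnergy σ V := fun V hV => csInf_le hbdd ⟨V, hV, rfl⟩
  choose U hUS hUe using heS
  have hI0 : 0 ≤ I := le_csInf (hne.image _) (by rintro _ ⟨V, -, rfl⟩; exact h.lpEnergy_nonneg V)
  have hcauchy : CauchySeq U := by
    rw [Metric.cauchySeq_iff]
    intro η hη
    have hm := h.pos
    have hη' : 0 < m * η ^ p := by positivity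
    -- Late terms have energy below `I + 1`, so this `ε` makes the first contribution at most `m η^p
    -- / 2`. The choice of `δ` does the same for the defect; `C + 1` in its denominator makes that
    -- bound strict and covers `C = 0`.
    obtain ⟨C, hC0, hC⟩ := h.exists_norm_sub_rpow_le (E := E) (p := p)
      (ε := m * η ^ p / (4 * (I + 1))) (by positivity)
    set δ := min 1 (m * η ^ p / (2 * (C + 1))) with hδ
    have hδ0 : 0 < δ := lt_min one_pos (by positivity)
    obtain ⟨N, hN⟩ := Filter.eventually_atTop.1 (he.eventually (gt_mem_nhds (by linarith : I < I + δ)))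
    refine ⟨N, fun k hk l hl => ?_⟩
    have h1 := hN k hk
    have h2 := hN l hl
    rw [← hUe] at h1 h2
    have h3 := hC (U k) (U l)
    have h4 : I ≤ lpEnergy σ ((1 / 2 : ℝ) • (U k + U l)) := by
      apply hIle
      rw [smul_add]
      exact hcv (hUS k) (hUS l) (by norm_num) (by norm_num) (by norm_num)
    have h5 : C * ((lpEnergy σ (U k) + lpEnergy σ (U l)) / 2 -
        lpEnergy σ ((1 / 2 : ℝ) • (U k + U l))) ≤ C * δ := by
      gcongr
      linarith
    have h6 : C * δ < m * η ^ p / 2 := by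
      calc C * δ ≤ C * (m * η ^ p / (2 * (C + 1))) := by
            gcongr
            exact min_le_right _ _
        _ < (C + 1) * (m * η ^ p / (2 * (C + 1))) := by
            gcongr
            linarith
        _ = m * η ^ p / 2 := by field_simp
    have h7 : m * η ^ p / (4 * (I + 1)) * (lpEnergy σ (U k) + lpEnergy σ (U l)) ≤
        m * η ^ p / 2 := by
      calc _ ≤ m * η ^ p / (4 * (I + 1)) * (2 * (I + 1)) := by
            gcongr
            have := min_le_left 1 (m * η ^ p / (2 * (C + 1)))
            linarith
        _ = m * η ^ p / 2 := by field_simp; norm_num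
    have h8 : m * ‖U k - U l‖ ^ p < m * η ^ p := by linarith
    rw [dist_eq_norm]
    exact (Real.rpow_lt_rpow_iff (norm_nonneg _) hη.le hp0).1 (lt_of_mul_lt_mul_left h8 hm.le)
  obtain ⟨W, hW⟩ := cauchySeq_tendsto_of_complete hcauchy
  refine ⟨W, hcl.mem_of_tendsto hW (Filter.Eventually.of_forall hUS), fun V hV => ?_⟩
  refine le_trans ?_ (hIle V hV)
  -- Lower semicontinuity: the tangent functional at `W` supports the energy from below, and its
  -- value at `U k - W` tends to zero.
  obtain ⟨L, hL⟩ := h.exists_firstVariation W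
  have hlim : Filter.Tendsto (fun k => lpEnergy σ W + p * L (U k - W)) Filter.atTop
      (nhds (lpEnergy σ W + p * L (W - W))) :=
    ((L.continuous.tendsto _).comp (hW.sub_const W)).const_mul p |>.const_add _
  rw [sub_self, map_zero, mul_zero, add_zero] at hlim
  refine le_of_tendsto_of_tendsto' hlim he fun k => ?_
  rw [hL, ← hUe]
  exact h.lpEnergy_add_le W (U k)

end WeightedLp

/-! ### Poincaré's inequality, existence of solutions and of Neumann data. -/

section SobolevTheory

variable {n : ℕ} {p : ℝ} {Ω : Set (EuclideanSpace ℝ (Fin n))}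

theorem fderiv_apply_eq_inner_gradient (φ : EuclideanSpace ℝ (Fin n) → ℝ)
    (x v : EuclideanSpace ℝ (Fin n)) : fderiv ℝ φ x v = inner ℝ (∇ φ x) v := by
  rw [gradient, InnerProductSpace.toDual_symm_apply]

/-- Poincaré's inequality for test functions. -/
theorem exists_integral_abs_rpow_le (hp : 1 < p) (hn : 0 < n) (hΩ : Bornology.IsBounded Ω) :
    ∃ C : ℝ, 0 ≤ C ∧ ∀ φ : EuclideanSpace ℝ (Fin n) → ℝ, IsTestFunction Ω φ →
      ∫ x, ‖φ x‖ ^ p ≤ C * ∫ x, ‖∇ φ x‖ ^ p := by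
  obtain ⟨R, hR0, hR⟩ := hΩ.exists_pos_norm_le
  have hp0 : 0 < p := by linarith
  have hp1 : 0 < p - 1 := by linarith
  -- This scaling of `‖∇ φ‖` in Young's inequality leaves `1/2` in front of `‖φ‖^p`, which can then
  -- be absorbed on the left.
  set l : ℝ := 2 * (p - 1) * R with hl
  have hl0 : 0 < l := by positivity
  refine ⟨l ^ p / (p - 1), by positivity, fun φ hφ => ?_⟩
  set e : EuclideanSpace ℝ (Fin n) := EuclideanSpace.single ⟨0, hn⟩ 1 with he
  have hen : ‖e‖ = 1 := by simp [he]
  have hφc := hφ.1.continuous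
  have hgc := hφ.continuous_gradient
  have hpow : Continuous fun x => ‖φ x‖ ^ p := hφc.norm.rpow_const fun _ => .inr hp0.le
  have hpows : HasCompactSupport fun x => ‖φ x‖ ^ p :=
    hφ.2.1.comp_left (g := fun t : ℝ => ‖t‖ ^ p) (by simp [Real.zero_rpow hp0.ne'])
  have hgpow : Continuous fun x => ‖∇ φ x‖ ^ p := hgc.norm.rpow_const fun _ => .inr hp0.le
  have hgpows : HasCompactSupport fun x => ‖∇ φ x‖ ^ p :=
    hφ.hasCompactSupport_gradient.comp_left (g := fun t => ‖t‖ ^ p)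
      (by simp [Real.zero_rpow hp0.ne'])
  have iφ : Integrable fun x => ‖φ x‖ ^ p := hpow.integrable_of_hasCompactSupport hpows
  have ig : Integrable fun x => ‖∇ φ x‖ ^ p := hgpow.integrable_of_hasCompactSupport hgpows
  have hd : ∀ x, HasFDerivAt (fun x => ‖φ x‖ ^ p)
      ((p * ‖φ x‖ ^ (p - 2)) • (innerSL ℝ (φ x)).comp (fderiv ℝ φ x)) x := fun x =>
    (hasFDerivAt_norm_rpow (φ x) hp).comp x (hφ.1.differentiable (by simp) x).hasFDerivAt
  have hd' : ∀ x, ((p * ‖φ x‖ ^ (p - 2)) • (innerSL ℝ (φ x)).comp (fderiv ℝ φ x)) e =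
      p * (pFlux p (φ x) * inner ℝ (∇ φ x) e) := fun x => by
    rw [← fderiv_apply_eq_inner_gradient]
    simp [pFlux]
    ring
  have hdc : Continuous fun x => inner ℝ e x * (p * (pFlux p (φ x) * inner ℝ (∇ φ x) e)) := by
    have := (continuous_pFlux (E := ℝ) hp).comp hφc
    simp only [Function.comp_def] at this
    fun_prop
  have hds : HasCompactSupport fun x => inner ℝ e x * (p * (pFlux p (φ x) * inner ℝ (∇ φ x) e)) :=
    hφ.2.1.mono fun x hx => by
      contrapose! hx
      simp only [Function.mem_support, not_not] at hx ⊢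
      simp [hx, pFlux]
  have idd := hdc.integrable_of_hasCompactSupport hds (μ := volume)
  -- The function `⟨e, x⟩` has derivative 1 along `e`, so `∫ |φ|^p = -∫ ⟨e, x⟩ ∂_e |φ|^p`; its size
  -- on `Ω` is at most `R`.
  have key := integral_bilinear_hasFDerivAt_right_eq_neg_left_of_integrable (μ := volume)
    (B := ContinuousLinearMap.mul ℝ ℝ) (v := e) (f := fun x => inner ℝ e x)
    (f' := fun _ => innerSL ℝ e) (g := fun x => ‖φ x‖ ^ p)
    (g' := fun x => (p * ‖φ x‖ ^ (p - 2)) • (innerSL ℝ (φ x)).comp (fderiv ℝ φ x))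
    (by simpa [hen] using iφ) (by simpa only [hd', ContinuousLinearMap.mul_apply'] using idd)
    ((show Continuous fun x => inner ℝ e x * ‖φ x‖ ^ p by fun_prop).integrable_of_hasCompactSupport
      (hpows.mul_left (f := fun x => inner ℝ e x)))
    (fun x _ => (innerSL ℝ e).hasFDerivAt) (fun x _ => hd x)
  simp only [hd', ContinuousLinearMap.mul_apply', innerSL_apply_apply, real_inner_self_eq_norm_sq,
    hen, one_pow, one_mul] at key
  have hpt : ∀ x, -(inner ℝ e x * (p * (pFlux p (φ x) * inner ℝ (∇ φ x) e))) ≤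
      1 / 2 * ‖φ x‖ ^ p + l ^ p / (2 * (p - 1)) * ‖∇ φ x‖ ^ p := by
    intro x
    by_cases hx : x ∈ Ω
    · have h1 : |inner ℝ e x| ≤ R := (abs_real_inner_le_norm _ _).trans (by
        rw [hen, one_mul]; exact hR x hx)
      have h2 : |inner ℝ (∇ φ x) e| ≤ ‖∇ φ x‖ := (abs_real_inner_le_norm _ _).trans (by
        rw [hen, mul_one])
      have h3 : |pFlux p (φ x)| = ‖φ x‖ ^ (p - 1) := norm_pFlux hp (φ x)
      have h4 := mul_rpow_sub_one_mul_le hp (norm_nonneg (φ x))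
        (b := l * ‖∇ φ x‖) (by positivity)
      rw [Real.mul_rpow hl0.le (norm_nonneg _)] at h4
      calc _ ≤ |inner ℝ e x * (p * (pFlux p (φ x) * inner ℝ (∇ φ x) e))| := neg_le_abs _
        _ = |inner ℝ e x| * (p * (‖φ x‖ ^ (p - 1) * |inner ℝ (∇ φ x) e|)) := by
          rw [abs_mul, abs_mul, abs_mul, h3, abs_of_pos hp0]
        _ ≤ R * (p * (‖φ x‖ ^ (p - 1) * ‖∇ φ x‖)) := by gcongr
        _ = 1 / (2 * (p - 1)) * (p * (‖φ x‖ ^ (p - 1) * (l * ‖∇ φ x‖))) := by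
          rw [hl]; field_simp
        _ ≤ 1 / (2 * (p - 1)) * ((p - 1) * ‖φ x‖ ^ p + l ^ p * ‖∇ φ x‖ ^ p) := by gcongr
        _ = _ := by field_simp
    · have : φ x = 0 := image_eq_zero_of_notMem_tsupport fun h => hx (hφ.2.2 h)
      simp only [this, pFlux, smul_zero, zero_mul, mul_zero, neg_zero]
      positivity
  have hmono := integral_mono idd.neg ((iφ.const_mul (1 / 2)).add
    (ig.const_mul (l ^ p / (2 * (p - 1))))) hpt
  simp only [Pi.neg_apply, Pi.add_apply] at hmono
  rw [integral_neg, key, neg_neg, integral_add (iφ.const_mul _) (ig.const_mul _),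
    integral_const_mul, integral_const_mul] at hmono
  have : l ^ p / (p - 1) * ∫ x, ‖∇ φ x‖ ^ p =
      2 * (l ^ p / (2 * (p - 1)) * ∫ x, ‖∇ φ x‖ ^ p) := by field_simp
  rw [this]
  linarith

variable [hp : Fact (1 < p)]

theorem IsTestFunction.setIntegral_norm_rpow {φ : EuclideanSpace ℝ (Fin n) → ℝ}
    (hφ : IsTestFunction Ω φ) : ∫ x in Ω, ‖φ x‖ ^ p = ∫ x, ‖φ x‖ ^ p := by
  refine setIntegral_eq_integral_of_forall_compl_eq_zero fun x hx => ?_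
  rw [image_eq_zero_of_notMem_tsupport fun h => hx (hφ.2.2 h), norm_zero,
    Real.zero_rpow (by linarith [hp.out])]

theorem IsTestFunction.setIntegral_norm_gradient_rpow {φ : EuclideanSpace ℝ (Fin n) → ℝ}
    (hφ : IsTestFunction Ω φ) : ∫ x in Ω, ‖∇ φ x‖ ^ p = ∫ x, ‖∇ φ x‖ ^ p := by
  refine setIntegral_eq_integral_of_forall_compl_eq_zero fun x hx => ?_
  have h : fderiv ℝ φ x = 0 := by
    by_contra h0
    exact hx (hφ.2.2 (support_fderiv_subset ℝ h0))
  rw [gradient, h, map_zero, norm_zero, Real.zero_rpow (by linarith [hp.out])]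

/-- The weak gradient as a continuous linear map on `W^{1,p}(Ω)`. -/
noncomputable def sobolevGradL (p : ℝ) [Fact (1 < p)] (Ω : Set (EuclideanSpace ℝ (Fin n))) :
    SobolevW p Ω →L[ℝ] Lp (EuclideanSpace ℝ (Fin n)) (ENNReal.ofReal p) (volume.restrict Ω) :=
  (ContinuousLinearMap.snd ℝ _ _).comp (SobolevW p Ω).subtypeL

/-- Poincaré's inequality in `W_0^{1,p}(Ω)`. -/
theorem exists_norm_le_of_mem_SobolevW0 (hn : 0 < n) (hΩ : Bornology.IsBounded Ω) :
    ∃ C : ℝ, 0 ≤ C ∧ ∀ v ∈ SobolevW0 p Ω, ‖v.1.1‖ ≤ C * ‖v.1.2‖ := by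
  obtain ⟨C, hC0, hC⟩ := exists_integral_abs_rpow_le hp.out hn hΩ
  have hp0 : 0 < p := by linarith [hp.out]
  refine ⟨C ^ p⁻¹, by positivity, fun v hv => ?_⟩
  have hcl : IsClosed {v : SobolevW p Ω | ‖v.1.1‖ ≤ C ^ p⁻¹ * ‖v.1.2‖} :=
    isClosed_le (by fun_prop) (by fun_prop)
  refine closure_minimal ?_ hcl hv
  rintro w ⟨φ, hφ, h1, h2⟩
  have e1 : ‖w.1.1‖ ^ p = ∫ x, ‖φ x‖ ^ p := by
    rw [lp_norm_rpow_eq_integral, ← hφ.setIntegral_norm_rpow]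
    exact integral_congr_ae (h1.mono fun x hx => by simp only [hx])
  have e2 : ‖w.1.2‖ ^ p = ∫ x, ‖∇ φ x‖ ^ p := by
    rw [lp_norm_rpow_eq_integral, ← hφ.setIntegral_norm_gradient_rpow]
    exact integral_congr_ae (h2.mono fun x hx => by simp only [hx])
  have h := hC φ hφ
  rw [← e1, ← e2] at h
  refine (Real.rpow_le_rpow_iff (norm_nonneg _) (by positivity) hp0).1 ?_
  rwa [Real.mul_rpow (by positivity) (norm_nonneg _), ← Real.rpow_mul hC0,
    inv_mul_cancel₀ hp0.ne', Real.rpow_one]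

/-- For a fixed test function both sides of the weak gradient identity are continuous in the pair,
because `φ` and `∇ φ` lie in the dual exponent space. -/
theorem isClosed_SobolevW : IsClosed (SobolevW p Ω : Set (Lp ℝ (ENNReal.ofReal p)
    (volume.restrict Ω) × Lp (EuclideanSpace ℝ (Fin n)) (ENNReal.ofReal p)
    (volume.restrict Ω))) := by
  have hc : p.HolderConjugate (p / (p - 1)) := Real.HolderConjugate.conjExponent hp.out
  have := hc.symm.ennrealOfReal
  have := hc.ennrealOfReal
  have : Fact (1 ≤ ENNReal.ofReal (p / (p - 1))) := ⟨by simpa using hc.symm.lt.le⟩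
  have hset : (SobolevW p Ω : Set (Lp ℝ (ENNReal.ofReal p) (volume.restrict Ω) ×
      Lp (EuclideanSpace ℝ (Fin n)) (ENNReal.ofReal p) (volume.restrict Ω))) =
      ⋂ (φ : EuclideanSpace ℝ (Fin n) → ℝ) (_ : IsTestFunction Ω φ),
        {w | ∫ x in Ω, w.1 x • ∇ φ x = -∫ x in Ω, φ x • w.2 x} := by
    ext w
    simp only [mem_iInter]
    rfl
  rw [hset]
  refine isClosed_iInter fun φ => isClosed_iInter fun hφ => ?_
  have hm : MemLp φ (ENNReal.ofReal (p / (p - 1))) (volume.restrict Ω) :=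
    (hφ.1.continuous.memLp_of_hasCompactSupport hφ.2.1).restrict Ω
  have hm' : MemLp (∇ φ) (ENNReal.ofReal (p / (p - 1))) (volume.restrict Ω) :=
    (hφ.continuous_gradient.memLp_of_hasCompactSupport hφ.hasCompactSupport_gradient).restrict Ω
  let B : ℝ →L[ℝ] EuclideanSpace ℝ (Fin n) →L[ℝ] EuclideanSpace ℝ (Fin n) :=
    ContinuousLinearMap.lsmul ℝ ℝ
  have e1 : ∀ u : Lp ℝ (ENNReal.ofReal p) (volume.restrict Ω),
      ∫ x in Ω, u x • ∇ φ x = B.lpPairing _ _ _ u (hm'.toLp _) := fun u => by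
    rw [ContinuousLinearMap.lpPairing_eq_integral]
    exact integral_congr_ae (hm'.coeFn_toLp.mono fun x hx => by simp only [hx]; rfl)
  have e2 : ∀ G : Lp (EuclideanSpace ℝ (Fin n)) (ENNReal.ofReal p) (volume.restrict Ω),
      ∫ x in Ω, φ x • G x = B.lpPairing _ _ _ (hm.toLp _) G := fun G => by
    rw [ContinuousLinearMap.lpPairing_eq_integral]
    exact integral_congr_ae (hm.coeFn_toLp.mono fun x hx => by simp only [hx]; rfl)
  simp only [e1, e2]
  exact isClosed_eq (by fun_prop) (by fun_prop)

instance : CompleteSpace (SobolevW p Ω) := isClosed_SobolevW.completeSpace_coe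

theorem SobolevW.norm_eq (v : SobolevW p Ω) : ‖v‖ = max ‖v.1.1‖ ‖v.1.2‖ := rfl

theorem sobolevGradL_apply (v : SobolevW p Ω) : sobolevGradL p Ω v = v.1.2 := rfl

theorem exists_norm_le_norm_sobolevGradL (hn : 0 < n) (hΩ : Bornology.IsBounded Ω) :
    ∃ C : ℝ, 0 ≤ C ∧ ∀ v ∈ SobolevW0 p Ω, ‖v‖ ≤ C * ‖sobolevGradL p Ω v‖ := by
  obtain ⟨C, hC0, hC⟩ := exists_norm_le_of_mem_SobolevW0 (p := p) hn hΩ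
  refine ⟨max C 1, le_max_of_le_left hC0, fun v hv => ?_⟩
  have h1 := hC v hv
  have h4 := norm_nonneg v.1.2
  have h5 := mul_le_mul_of_nonneg_right (le_max_left C 1) h4
  have h6 := mul_le_mul_of_nonneg_right (le_max_right C 1) h4
  rw [SobolevW.norm_eq, sobolevGradL_apply]
  exact max_le (by linarith) (by linarith)

theorem isClosed_map_of_norm_le {E F : Type*} [NormedAddCommGroup E] [NormedSpace ℝ E]
    [CompleteSpace E] [NormedAddCommGroup F] [NormedSpace ℝ F] (T : E →L[ℝ] F)
    {S : Submodule ℝ E} (hS : IsClosed (S : Set E)) {C : ℝ} (hC0 : 0 ≤ C)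
    (hC : ∀ v ∈ S, ‖v‖ ≤ C * ‖T v‖) : IsClosed (S.map T.toLinearMap : Set F) := by
  have : CompleteSpace S := hS.completeSpace_coe
  lift C to NNReal using hC0
  have hT : AntilipschitzWith C (T.comp S.subtypeL) :=
    (T.comp S.subtypeL).antilipschitz_of_bound fun v => hC v.1 v.2
  convert hT.isClosed_range (T.comp S.subtypeL).uniformContinuous using 1
  ext G
  simp

/-- The energy sees only gradients, so minimization takes place among them. Poincaré bounds the
gradient map below on `SobolevW0`, which makes its image closed. -/
theorem isClosed_map_sobolevGradL (hn : 0 < n) (hΩ : Bornology.IsBounded Ω) :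
    IsClosed ((SobolevW0 p Ω).map (sobolevGradL p Ω).toLinearMap :
      Set (Lp (EuclideanSpace ℝ (Fin n)) (ENNReal.ofReal p) (volume.restrict Ω))) := by
  obtain ⟨C, hC0, hC⟩ := exists_norm_le_norm_sobolevGradL (p := p) hn hΩ
  exact isClosed_map_of_norm_le _ (Submodule.isClosed_topologicalClosure _) hC0 hC

theorem sobolevTrace_eq_iff {u v : SobolevW p Ω} :
    sobolevTrace u = sobolevTrace v ↔ u - v ∈ SobolevW0 p Ω :=
  Submodule.Quotient.eq _

variable {σ : EuclideanSpace ℝ (Fin n) → ℝ} {m M : ℝ}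

theorem exists_isSolution (hn : 0 < n) (hΩ : Bornology.IsBounded Ω)
    (h : IsBoundedWeight (volume.restrict Ω) σ m M) (f : BoundarySpace p Ω) :
    ∃ u : SobolevW p Ω, IsSolution σ f u := by
  obtain ⟨u₀, rfl⟩ : ∃ u₀ : SobolevW p Ω, sobolevTrace u₀ = f :=
    Submodule.mkQ_surjective _ f
  set S : Submodule ℝ _ := (SobolevW0 p Ω).map (sobolevGradL p Ω).toLinearMap with hS
  have hScl := isClosed_map_sobolevGradL (p := p) hn hΩ
  obtain ⟨U, hU, hmin⟩ := h.exists_forall_lpEnergy_le (p := p)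
    (S := (fun G => G - u₀.1.2) ⁻¹' S) ⟨u₀.1.2, by simp⟩
    (hScl.preimage (by fun_prop)) (by
      simpa only [sub_eq_add_neg] using S.convex.translate_preimage_left (-u₀.1.2))
  obtain ⟨v, hv, hvU⟩ := hU
  have hvU' : v.1.2 = U - u₀.1.2 := hvU
  refine ⟨u₀ + v, sobolevTrace_eq_iff.2 (by simpa using hv), fun w hw => ?_⟩
  have h1 : (u₀ + v).1.2 = U := by
    change u₀.1.2 + v.1.2 = U
    rw [hvU']; abel
  change lpEnergy σ (u₀ + v).1.2 ≤ lpEnergy σ w.1.2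
  rw [h1]
  exact hmin _ ⟨w - u₀, sobolevTrace_eq_iff.1 hw, rfl⟩

/-- The Euler–Lagrange equation. -/
theorem IsSolution.integral_flux_eq_zero (h : IsBoundedWeight (volume.restrict Ω) σ m M)
    {f : BoundarySpace p Ω} {u : SobolevW p Ω} (hu : IsSolution σ f u) {v : SobolevW p Ω}
    (hv : v ∈ SobolevW0 p Ω) :
    ∫ x in Ω, σ x * inner ℝ (pFlux p (u.1.2 x)) (v.1.2 x) = 0 := by
  have hp0 : p ≠ 0 := by linarith [hp.out]
  have hmin : IsLocalMin (fun t : ℝ => lpEnergy σ (u.1.2 + t • v.1.2)) 0 :=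
    Filter.Eventually.of_forall fun t => by
      have ht : sobolevTrace (u + t • v) = f := by
        rw [← hu.1, sobolevTrace_eq_iff, add_sub_cancel_left]
        exact Submodule.smul_mem _ _ hv
      have := hu.2 _ ht
      simp only [zero_smul, add_zero]
      exact this
  exact (mul_eq_zero.1 (hmin.hasDerivAt_eq_zero (h.hasDerivAt_lpEnergy u.1.2 v.1.2))).resolve_left
    hp0

/-- The first variation at a minimizer vanishes on `SobolevW0` by the Euler–Lagrange equation, so it
descends to a continuous functional on the quotient. -/
theorem exists_isNeumannData (hn : 0 < n) (hΩ : Bornology.IsBounded Ω)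
    (h : IsBoundedWeight (volume.restrict Ω) σ m M) (f : BoundarySpace p Ω) :
    ∃ Λ, IsNeumannData σ f Λ := by
  obtain ⟨u, hu⟩ := exists_isSolution hn hΩ h f
  obtain ⟨L, hL⟩ := h.exists_firstVariation u.1.2
  refine ⟨(SobolevW0 p Ω).liftQL (L.comp (sobolevGradL p Ω)) fun v hv => ?_, u, hu, fun v => ?_⟩
  · change L v.1.2 = 0
    rw [hL]
    exact hu.integral_flux_eq_zero h hv
  · change L v.1.2 = _
    rw [hL]
    exact integral_congr_ae (ae_of_all _ fun x => (mul_norm_rpow_mul_inner _ _ _).symm)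

/-- The pairing of `Λ_σ f` with `f` is the minimal energy. -/
theorem exists_isSolution_dnMap_eq (hn : 0 < n) (hΩ : Bornology.IsBounded Ω)
    (h : IsBoundedWeight (volume.restrict Ω) σ m M) (w : SobolevW p Ω) :
    ∃ u : SobolevW p Ω, IsSolution σ (sobolevTrace w) u ∧
      dnMap p Ω σ (sobolevTrace w) (sobolevTrace w) = dirichletEnergy σ u := by
  have hex := exists_isNeumannData hn hΩ h (sobolevTrace w)
  have hspec : IsNeumannData σ (sobolevTrace w) (dnMap p Ω σ (sobolevTrace w)) := by
    rw [dnMap, dif_pos hex]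
    exact hex.choose_spec
  obtain ⟨u, hu, hΛ⟩ := hspec
  refine ⟨u, hu, ?_⟩
  -- Only the class being paired is rewritten, so that `u` itself becomes the test representative.
  nth_rewrite 2 [← hu.1]
  rw [hΛ]
  refine integral_congr_ae (ae_of_all _ fun x => ?_)
  simp only [mul_norm_rpow_mul_inner, inner_pFlux_self hp.out]

end SobolevTheory

/-! ### The one-dimensional profile of Wolff's solutions. -/

section WolffProfile

/-- The arc parameter of Wolff's profile as a function of the phase angle. -/
noncomputable def wolffParam (p θ : ℝ) : ℝ :=
  (p / 2 * θ - (p - 2) / 4 * Real.sin (2 * θ)) / (p - 1)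

theorem wolffSpeed_pos {p : ℝ} (hp : 1 < p) (θ : ℝ) : 0 < 1 + (p - 2) * Real.sin θ ^ 2 := by
  have h1 := Real.sin_sq_le_one θ
  have h2 := sq_nonneg (Real.sin θ)
  rcases le_total 2 p with h | h <;> nlinarith

theorem hasDerivAt_wolffParam (p θ : ℝ) :
    HasDerivAt (wolffParam p) ((1 + (p - 2) * Real.sin θ ^ 2) / (p - 1)) θ := by
  have h1 : HasDerivAt (fun θ : ℝ => Real.sin (2 * θ)) (Real.cos (2 * θ) * 2) θ := by
    simpa using ((hasDerivAt_id θ).const_mul 2).sin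
  refine ((((hasDerivAt_id θ).const_mul (p / 2)).sub (h1.const_mul ((p - 2) / 4))).div_const
    (p - 1)).congr_deriv ?_
  rw [Real.cos_two_mul, Real.cos_sq']
  ring

theorem continuous_wolffParam (p : ℝ) : Continuous (wolffParam p) :=
  continuous_iff_continuousAt.2 fun θ => (hasDerivAt_wolffParam p θ).continuousAt

theorem strictMono_wolffParam {p : ℝ} (hp : 1 < p) : StrictMono (wolffParam p) :=
  strictMono_of_deriv_pos fun θ => by
    rw [(hasDerivAt_wolffParam p θ).deriv]
    exact div_pos (wolffSpeed_pos hp θ) (by linarith)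

theorem surjective_wolffParam {p : ℝ} (hp : 1 < p) : Function.Surjective (wolffParam p) := by
  have hp1 : 0 < p - 1 := by linarith
  have hlin : Filter.Tendsto (fun θ : ℝ => p / 2 * θ) Filter.atTop Filter.atTop :=
    Filter.tendsto_id.const_mul_atTop (by linarith)
  have hlin' : Filter.Tendsto (fun θ : ℝ => p / 2 * θ) Filter.atBot Filter.atBot :=
    Filter.tendsto_id.const_mul_atBot (by linarith)
  have hb : ∀ θ : ℝ, |(p - 2) / 4 * Real.sin (2 * θ)| ≤ |(p - 2) / 4| := fun θ => by
    rw [abs_mul]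
    exact mul_le_of_le_one_right (abs_nonneg _) (Real.abs_sin_le_one _)
  refine (continuous_wolffParam p).surjective ?_ ?_
  · refine (Filter.tendsto_atTop_mono (fun θ => ?_)
      (Filter.tendsto_atTop_add_const_right _ (-|(p - 2) / 4|) hlin)).atTop_div_const hp1
    linarith [(abs_le.1 (hb θ)).2]
  · refine (Filter.tendsto_atBot_mono (fun θ => ?_)
      (Filter.tendsto_atBot_add_const_right _ (|(p - 2) / 4|) hlin')).atBot_div_const hp1
    linarith [(abs_le.1 (hb θ)).1]

/-- Separation of variables: the solution of this autonomous equation is the inverse function of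
`wolffParam p`. -/
theorem exists_wolffAngle {p : ℝ} (hp : 1 < p) : ∃ θ : ℝ → ℝ, ∀ s,
    HasDerivAt θ ((p - 1) / (1 + (p - 2) * Real.sin (θ s) ^ 2)) s := by
  let e := (strictMono_wolffParam hp).orderIsoOfSurjective _ (surjective_wolffParam hp)
  refine ⟨e.symm, fun s => ?_⟩
  have hne := div_pos (wolffSpeed_pos hp (e.symm s)) (by linarith : 0 < p - 1)
  have h := HasDerivAt.of_local_left_inverse (f := wolffParam p) (g := e.symm) (a := s)
    e.symm.continuous.continuousAt (hasDerivAt_wolffParam p _) hne.ne'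
    (Filter.Eventually.of_forall fun y => e.apply_symm_apply y)
  simpa using h

/-- Wolff's profile: `e^{-t} a(s)` solves the planar `p`-Laplace equation, and its gradient
`e^{-t} (-a, -b)` has length `e^{-t} r`. -/
theorem exists_wolffProfile {p : ℝ} (hp : 1 < p) : ∃ (a b r : ℝ → ℝ) (k : ℝ),
    Continuous b ∧ Continuous r ∧ (∀ s, a s ^ 2 + b s ^ 2 = r s ^ 2) ∧
    (∀ s, Real.exp (-k) ≤ r s ∧ r s ≤ Real.exp k) ∧ (∀ s, HasDerivAt a (-b s) s) ∧
    ∀ s, HasDerivAt (fun s => r s ^ (p - 2) * b s) ((p - 1) * (r s ^ (p - 2) * a s)) s := by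
  obtain ⟨θ, hθ⟩ := exists_wolffAngle hp
  have hp1 : p - 1 ≠ 0 := by linarith
  -- In polar form `a = r cos θ`, `b = r sin θ`, the two required equations are linear in `θ'` and
  -- `r'/r`. Solving them gives the equation for `θ` and `(log r)' = c (sin² θ)'`, hence `r = exp (c
  -- sin² θ)`, bounded between `e^{±|c|}`.
  set c : ℝ := (p - 2) / (2 * (p - 1)) with hc
  have hθc : Continuous θ := continuous_iff_continuousAt.2 fun s => (hθ s).continuousAt
  have hsin : ∀ s, HasDerivAt (fun s => Real.sin (θ s))
      (Real.cos (θ s) * ((p - 1) / (1 + (p - 2) * Real.sin (θ s) ^ 2))) s := fun s => (hθ s).sin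
  have hcos : ∀ s, HasDerivAt (fun s => Real.cos (θ s))
      (-Real.sin (θ s) * ((p - 1) / (1 + (p - 2) * Real.sin (θ s) ^ 2))) s := fun s => (hθ s).cos
  have hexp : ∀ (q s : ℝ), HasDerivAt (fun s => Real.exp (q * Real.sin (θ s) ^ 2))
      (Real.exp (q * Real.sin (θ s) ^ 2) * (q * (2 * Real.sin (θ s) *
        (Real.cos (θ s) * ((p - 1) / (1 + (p - 2) * Real.sin (θ s) ^ 2)))))) s := fun q s => by
    simpa using (((hsin s).pow 2).const_mul q).exp
  have hr : ∀ s, Real.exp (c * Real.sin (θ s) ^ 2) ^ (p - 2) =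
      Real.exp ((c * (p - 2)) * Real.sin (θ s) ^ 2) := fun s => by
    rw [← Real.exp_mul]
    ring_nf
  refine ⟨fun s => Real.exp (c * Real.sin (θ s) ^ 2) * Real.cos (θ s),
    fun s => Real.exp (c * Real.sin (θ s) ^ 2) * Real.sin (θ s),
    fun s => Real.exp (c * Real.sin (θ s) ^ 2), |c|, by fun_prop, by fun_prop, fun s => ?_,
    fun s => ?_, fun s => ?_, fun s => ?_⟩
  · rw [mul_pow, mul_pow, ← mul_add, add_comm, Real.sin_sq_add_cos_sq, mul_one]
  · have h1 : |c * Real.sin (θ s) ^ 2| ≤ |c| := by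
      rw [abs_mul, abs_of_nonneg (sq_nonneg (Real.sin (θ s)))]
      exact mul_le_of_le_one_right (abs_nonneg _) (Real.sin_sq_le_one _)
    exact ⟨Real.exp_le_exp.2 (abs_le.1 h1).1, Real.exp_le_exp.2 (abs_le.1 h1).2⟩
  · refine ((hexp c s).mul (hcos s)).congr_deriv ?_
    have hD := (wolffSpeed_pos hp (θ s)).ne'
    have hcs := Real.cos_sq' (θ s)
    rw [hc]
    field_simp
    rw [hcs]
    ring
  · simp only [hr, ← mul_assoc, ← Real.exp_add, ← add_mul]
    refine ((hexp (c * (p - 2) + c) s).mul (hsin s)).congr_deriv ?_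
    have hD := (wolffSpeed_pos hp (θ s)).ne'
    have hcs := Real.cos_sq' (θ s)
    have hq : c * (p - 2) + c = (p - 2) / 2 := by rw [hc]; field_simp; ring
    rw [hq]
    field_simp
    ring

end WolffProfile

/-! ### Classical functions as Sobolev functions, and weak equations tested on `SobolevW0`. -/

section ClassicalToWeak

variable {n : ℕ} {Ω : Set (EuclideanSpace ℝ (Fin n))}

theorem IsTestFunction.hasFDerivAt {φ : EuclideanSpace ℝ (Fin n) → ℝ} (hφ : IsTestFunction Ω φ)
    (x : EuclideanSpace ℝ (Fin n)) : HasFDerivAt φ (fderiv ℝ φ x) x :=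
  (hφ.1.differentiable (by simp) x).hasFDerivAt

theorem IsTestFunction.gradient_eq_zero {φ : EuclideanSpace ℝ (Fin n) → ℝ}
    (hφ : IsTestFunction Ω φ) {x : EuclideanSpace ℝ (Fin n)} (hx : x ∉ Ω) : ∇ φ x = 0 := by
  have h : fderiv ℝ φ x = 0 := by
    by_contra h0
    exact hx (hφ.2.2 (support_fderiv_subset ℝ h0))
  rw [gradient, h, map_zero]

theorem IsTestFunction.eq_zero {φ : EuclideanSpace ℝ (Fin n) → ℝ}
    (hφ : IsTestFunction Ω φ) {x : EuclideanSpace ℝ (Fin n)} (hx : x ∉ Ω) : φ x = 0 :=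
  image_eq_zero_of_notMem_tsupport fun h => hx (hφ.2.2 h)

/-- Integration by parts against a test function in the direction `v`. -/
theorem IsTestFunction.integral_mul_inner_gradient {φ : EuclideanSpace ℝ (Fin n) → ℝ}
    (hφ : IsTestFunction Ω φ) {f f' : EuclideanSpace ℝ (Fin n) → ℝ}
    {v : EuclideanSpace ℝ (Fin n)} (hf : Continuous f) (hf' : Continuous f')
    (hd : ∀ x, HasLineDerivAt ℝ f (f' x) x v) :
    ∫ x, f x * inner ℝ (∇ φ x) v = -∫ x, f' x * φ x := by
  have hφc := hφ.1.continuous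
  have hgc := hφ.continuous_gradient
  have hgs : HasCompactSupport fun x => inner ℝ (∇ φ x) v :=
    hφ.hasCompactSupport_gradient.comp_left (g := fun y => inner ℝ y v) (by simp)
  refine integral_bilinear_hasLineDerivAt_right_eq_neg_left_of_integrable
    (B := ContinuousLinearMap.mul ℝ ℝ) (g := φ) (g' := fun x => inner ℝ (∇ φ x) v) ?_ ?_ ?_
    (fun x _ => hd x) fun x _ => ?_
  · exact (hf'.mul hφc).integrable_of_hasCompactSupport hφ.2.1.mul_left
  · exact (hf.mul (by fun_prop)).integrable_of_hasCompactSupport hgs.mul_left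
  · exact (hf.mul hφc).integrable_of_hasCompactSupport hφ.2.1.mul_left
  · rw [← fderiv_apply_eq_inner_gradient]
    exact (hφ.hasFDerivAt x).hasLineDerivAt v

theorem hasWeakGradient_of_hasGradientAt {h : EuclideanSpace ℝ (Fin n) → ℝ}
    {G : EuclideanSpace ℝ (Fin n) → EuclideanSpace ℝ (Fin n)}
    (hd : ∀ x, HasGradientAt h (G x) x) (hG : Continuous G) : HasWeakGradient Ω h G := by
  intro φ hφ
  have hhc : Continuous h := continuous_iff_continuousAt.2 fun x => (hd x).continuousAt
  have hφc := hφ.1.continuous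
  have hgc := hφ.continuous_gradient
  have i1 : Integrable fun x => h x • ∇ φ x :=
    (hhc.smul hgc).integrable_of_hasCompactSupport hφ.hasCompactSupport_gradient.smul_left
  have i2 : Integrable fun x => φ x • G x :=
    (hφc.smul hG).integrable_of_hasCompactSupport hφ.2.1.smul_right
  rw [setIntegral_eq_integral_of_forall_compl_eq_zero fun x hx => by
      rw [hφ.gradient_eq_zero hx, smul_zero],
    setIntegral_eq_integral_of_forall_compl_eq_zero fun x hx => by
      rw [hφ.eq_zero hx, zero_smul]]
  refine ext_inner_left ℝ fun v => ?_
  rw [inner_neg_right, ← integral_inner i1, ← integral_inner i2]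
  have key := hφ.integral_mul_inner_gradient (f := h) (f' := fun x => inner ℝ (G x) v) (v := v)
    hhc (by fun_prop) fun x => by
      simpa using (hd x).hasFDerivAt.hasLineDerivAt v
  simp only [real_inner_smul_right]
  calc ∫ x, h x * inner ℝ v (∇ φ x) = ∫ x, h x * inner ℝ (∇ φ x) v := by
        simp only [real_inner_comm]
    _ = -∫ x, inner ℝ (G x) v * φ x := key
    _ = -∫ x, φ x * inner ℝ v (G x) := by
        congr 1
        refine integral_congr_ae (ae_of_all _ fun x => ?_)
        simp only [real_inner_comm, mul_comm]

variable {p : ℝ} [hp : Fact (1 < p)]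

theorem Continuous.memLp_restrict_of_isBounded {E F : Type*} [NormedAddCommGroup E]
    [ProperSpace E] [MeasurableSpace E] [BorelSpace E] {μ : Measure E}
    [IsFiniteMeasureOnCompacts μ] [NormedAddCommGroup F] [SecondCountableTopology F]
    {Ω : Set E} (hΩ : Bornology.IsBounded Ω) {f : E → F} (hf : Continuous f) (q : ℝ≥0∞) :
    MemLp f q (μ.restrict Ω) := by
  obtain ⟨C, hC⟩ := hΩ.isCompact_closure.exists_bound_of_continuousOn hf.continuousOn
  have hfin : IsFiniteMeasure (μ.restrict (closure Ω)) :=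
    ⟨by simpa using hΩ.isCompact_closure.measure_lt_top⟩
  have h : MemLp f q (μ.restrict (closure Ω)) :=
    MemLp.of_bound hf.aestronglyMeasurable C
      (ae_restrict_of_forall_mem isClosed_closure.measurableSet hC)
  exact h.mono_measure (Measure.restrict_mono subset_closure le_rfl)

/-- A `C^1` function on `ℝⁿ` restricts to an element of `W^{1,p}(Ω)` for bounded `Ω`. -/
theorem exists_sobolevW_of_hasGradientAt (hΩ : Bornology.IsBounded Ω)
    {h : EuclideanSpace ℝ (Fin n) → ℝ} {G : EuclideanSpace ℝ (Fin n) → EuclideanSpace ℝ (Fin n)}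
    (hd : ∀ x, HasGradientAt h (G x) x) (hG : Continuous G) :
    ∃ w : SobolevW p Ω, w.1.2 =ᵐ[volume.restrict Ω] G := by
  have hhc : Continuous h := continuous_iff_continuousAt.2 fun x => (hd x).continuousAt
  have m1 := hhc.memLp_restrict_of_isBounded (μ := volume) hΩ (ENNReal.ofReal p)
  have m2 := hG.memLp_restrict_of_isBounded (μ := volume) hΩ (ENNReal.ofReal p)
  refine ⟨⟨(m1.toLp h, m2.toLp G), fun φ hφ => ?_⟩, m2.coeFn_toLp⟩
  have e1 : ∫ x in Ω, (m1.toLp h) x • ∇ φ x = ∫ x in Ω, h x • ∇ φ x :=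
    integral_congr_ae (m1.coeFn_toLp.mono fun x hx => by simp only [hx])
  have e2 : ∫ x in Ω, φ x • (m2.toLp G) x = ∫ x in Ω, φ x • G x :=
    integral_congr_ae (m2.coeFn_toLp.mono fun x hx => by simp only [hx])
  change ∫ x in Ω, (m1.toLp h) x • ∇ φ x = -∫ x in Ω, φ x • (m2.toLp G) x
  rw [e1, e2]
  exact hasWeakGradient_of_hasGradientAt hd hG φ hφ

theorem isBoundedWeight_one {α : Type*} [MeasurableSpace α] (μ : Measure α) :
    IsBoundedWeight μ (fun _ => 1) 1 1 :=
  ⟨aestronglyMeasurable_const, one_pos, ae_of_all _ fun _ => le_rfl, ae_of_all _ fun _ => le_rfl⟩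

/-- A weakly divergence-free flux annihilates the gradients of `W_0^{1,p}(Ω)`. -/
theorem integral_inner_pFlux_eq_zero_of_mem_SobolevW0
    {H : Lp (EuclideanSpace ℝ (Fin n)) (ENNReal.ofReal p) (volume.restrict Ω)}
    (hH : ∀ φ, IsTestFunction Ω φ → ∫ x in Ω, inner ℝ (pFlux p (H x)) (∇ φ x) = 0)
    {v : SobolevW p Ω} (hv : v ∈ SobolevW0 p Ω) :
    ∫ x in Ω, inner ℝ (pFlux p (H x)) (v.1.2 x) = 0 := by
  obtain ⟨L, hL⟩ := (isBoundedWeight_one (volume.restrict Ω)).exists_firstVariation H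
  simp only [one_mul] at hL
  have hcl : IsClosed {v : SobolevW p Ω | L (sobolevGradL p Ω v) = 0} :=
    isClosed_eq (by fun_prop) continuous_const
  rw [← hL]
  refine closure_minimal ?_ hcl hv
  rintro w ⟨φ, hφ, -, h2⟩
  change L w.1.2 = 0
  rw [hL, ← hH φ hφ]
  exact integral_congr_ae (h2.mono fun x hx => by simp only [hx])

end ClassicalToWeak

/-! ### Exponentially concentrated `p`-harmonic functions in `ℝⁿ`. -/

section WolffSolution

/-- Wolff's solutions `e^{-⟨N, x - x₀⟩} a(⟨T, x - x₀⟩)` of the `p`-Laplace equation. The size of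
their gradients is comparable to an exponential. -/
theorem exists_wolffSolution (p : ℝ) [hp : Fact (1 < p)] : ∃ k : ℝ,
    ∀ {n : ℕ} {Ω : Set (EuclideanSpace ℝ (Fin n))}, Bornology.IsBounded Ω →
    ∀ N T x₀ : EuclideanSpace ℝ (Fin n), inner ℝ N T = 0 → ‖T‖ = ‖N‖ →
    ∃ w : SobolevW p Ω,
      (∀ᵐ x ∂volume.restrict Ω,
        Real.exp (-k) * (‖N‖ * Real.exp (-inner ℝ N (x - x₀))) ≤ ‖w.1.2 x‖ ∧
        ‖w.1.2 x‖ ≤ Real.exp k * (‖N‖ * Real.exp (-inner ℝ N (x - x₀)))) ∧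
      ∀ v ∈ SobolevW0 p Ω, ∫ x in Ω, inner ℝ (pFlux p (w.1.2 x)) (v.1.2 x) = 0 := by
  -- The constant `k` comes from the profile alone, before `Ω`, `N` and `T` are chosen, so the
  -- gradient bounds stay uniform as `‖N‖` grows.
  obtain ⟨a, b, r, k, hbc, hrc, hab, hk, hda, hdb⟩ := exists_wolffProfile hp.out
  refine ⟨k, fun {n Ω} hΩ N T x₀ hNT hT => ?_⟩
  have hac : Continuous a := continuous_iff_continuousAt.2 fun s => (hda s).continuousAt
  have hr0 : ∀ s, 0 < r s := fun s => (Real.exp_pos _).trans_le (hk s).1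
  have hAc : Continuous fun s => r s ^ (p - 2) := hrc.rpow_const fun s => .inl (hr0 s).ne'
  have hTN : inner ℝ T N = 0 := by rw [real_inner_comm, hNT]
  let t : EuclideanSpace ℝ (Fin n) → ℝ := fun x => inner ℝ N (x - x₀)
  let s : EuclideanSpace ℝ (Fin n) → ℝ := fun x => inner ℝ T (x - x₀)
  have ht : Continuous t := by fun_prop
  have hs : Continuous s := by fun_prop
  let G : EuclideanSpace ℝ (Fin n) → EuclideanSpace ℝ (Fin n) := fun x =>
    -Real.exp (-t x) • (a (s x) • N + b (s x) • T)
  have hGc : Continuous G := by fun_prop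
  have hGn : ∀ x, ‖G x‖ = Real.exp (-t x) * (‖N‖ * r (s x)) := fun x => by
    have h1 : ‖a (s x) • N + b (s x) • T‖ ^ 2 = (‖N‖ * r (s x)) ^ 2 := by
      rw [norm_add_sq_real, real_inner_smul_left, real_inner_smul_right, hNT, norm_smul, norm_smul,
        mul_pow, mul_pow, hT, mul_pow, ← hab, Real.norm_eq_abs, Real.norm_eq_abs, sq_abs, sq_abs]
      ring
    have h2 := (pow_left_inj₀ (norm_nonneg _)
      (mul_nonneg (norm_nonneg N) (hr0 (s x)).le) two_ne_zero).1 h1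
    simp only [G]
    rw [norm_smul, h2, norm_neg, Real.norm_of_nonneg (Real.exp_pos _).le]
  have hd : ∀ x, HasGradientAt (fun x => Real.exp (-t x) * a (s x)) (G x) x := fun x => by
    have dt : HasFDerivAt t (innerSL ℝ N) x :=
      (innerSL ℝ N).hasFDerivAt.comp x ((hasFDerivAt_id x).sub_const x₀)
    have ds : HasFDerivAt s (innerSL ℝ T) x :=
      (innerSL ℝ T).hasFDerivAt.comp x ((hasFDerivAt_id x).sub_const x₀)
    rw [hasGradientAt_iff_hasFDerivAt]
    refine (dt.neg.exp.mul ((hda (s x)).comp_hasFDerivAt x ds)).congr_fderiv ?_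
    ext y
    simp [G]
    ring
  obtain ⟨w, hw⟩ := exists_sobolevW_of_hasGradientAt (p := p) hΩ hd hGc
  refine ⟨w, ?_, fun v hv => integral_inner_pFlux_eq_zero_of_mem_SobolevW0 (fun φ hφ => ?_) hv⟩
  · filter_upwards [hw] with x hx
    rw [hx, hGn]
    have h1 := hk (s x)
    have h2 : 0 ≤ ‖N‖ * Real.exp (-t x) := by positivity
    have h3 := mul_le_mul_of_nonneg_right h1.1 h2
    have h4 := mul_le_mul_of_nonneg_right h1.2 h2
    have h5 : Real.exp (-t x) * (‖N‖ * r (s x)) = r (s x) * (‖N‖ * Real.exp (-t x)) := by ring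
    rw [h5]
    exact ⟨h3, h4⟩
  -- Up to a constant factor the flux is `f N + g T`. It is divergence-free because the derivative
  -- of `f` along `N` cancels that of `g` along `T`.
  · let f : EuclideanSpace ℝ (Fin n) → ℝ := fun x =>
      Real.exp (-(p - 1) * t x) * (r (s x) ^ (p - 2) * a (s x))
    let g : EuclideanSpace ℝ (Fin n) → ℝ := fun x =>
      Real.exp (-(p - 1) * t x) * (r (s x) ^ (p - 2) * b (s x))
    have hAs := hAc.comp hs
    simp only [Function.comp_def] at hAs
    have hfc : Continuous f := by fun_prop
    have hgc : Continuous g := by fun_prop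
    have hflux : ∀ x, pFlux p (G x) = -‖N‖ ^ (p - 2) • (f x • N + g x • T) := fun x => by
      have h1 : Real.exp (-t x) ^ (p - 2) * Real.exp (-t x) = Real.exp (-(p - 1) * t x) := by
        rw [← Real.exp_mul, ← Real.exp_add]
        ring_nf
      rw [pFlux, hGn, Real.mul_rpow (Real.exp_pos _).le (mul_nonneg (norm_nonneg N) (hr0 _).le),
        Real.mul_rpow (norm_nonneg N) (hr0 _).le]
      simp only [f, g, G, ← h1]
      module
    have hfd : ∀ x, HasLineDerivAt ℝ f (-((p - 1) * ‖N‖ ^ 2 * f x)) x N := fun x => by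
      have e1 : ∀ y : ℝ, t (x + y • N) = t x + y * ‖N‖ ^ 2 := fun y => by
        simp only [t]
        rw [add_sub_right_comm, inner_add_right, real_inner_smul_right, real_inner_self_eq_norm_sq]
      have e2 : ∀ y : ℝ, s (x + y • N) = s x := fun y => by
        simp only [s]
        rw [add_sub_right_comm, inner_add_right, real_inner_smul_right, hTN, mul_zero, add_zero]
      simp only [HasLineDerivAt, f, e1, e2]
      have h1 : HasDerivAt (fun y : ℝ => -(p - 1) * (t x + y * ‖N‖ ^ 2))
          (-(p - 1) * ‖N‖ ^ 2) 0 := by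
        simpa using (((hasDerivAt_id (0 : ℝ)).mul_const (‖N‖ ^ 2)).const_add (t x)).const_mul
          (-(p - 1))
      refine (h1.exp.mul_const (r (s x) ^ (p - 2) * a (s x))).congr_deriv ?_
      simp only [zero_mul, add_zero]
      ring
    have hgd : ∀ x, HasLineDerivAt ℝ g ((p - 1) * ‖N‖ ^ 2 * f x) x T := fun x => by
      have e1 : ∀ y : ℝ, t (x + y • T) = t x := fun y => by
        simp only [t]
        rw [add_sub_right_comm, inner_add_right, real_inner_smul_right, hNT, mul_zero, add_zero]
      have e2 : ∀ y : ℝ, s (x + y • T) = s x + y * ‖N‖ ^ 2 := fun y => by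
        simp only [s]
        rw [add_sub_right_comm, inner_add_right, real_inner_smul_right, real_inner_self_eq_norm_sq,
          hT]
      simp only [HasLineDerivAt, f, g, e1, e2]
      have h1 : HasDerivAt (fun y : ℝ => s x + y * ‖N‖ ^ 2) (‖N‖ ^ 2) 0 := by
        simpa using ((hasDerivAt_id (0 : ℝ)).mul_const (‖N‖ ^ 2)).const_add (s x)
      have h2 : HasDerivAt (fun σ => r σ ^ (p - 2) * b σ)
          ((p - 1) * (r (s x) ^ (p - 2) * a (s x))) (s x + 0 * ‖N‖ ^ 2) := by
        simpa using hdb (s x)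
      refine ((h2.comp (0 : ℝ) h1).const_mul (Real.exp (-(p - 1) * t x))).congr_deriv ?_
      ring
    have hφc := hφ.1.continuous
    have hgrc := hφ.continuous_gradient
    have iN : Integrable fun x => f x * inner ℝ (∇ φ x) N :=
      (show Continuous fun x => f x * inner ℝ (∇ φ x) N by fun_prop).integrable_of_hasCompactSupport
        (hφ.hasCompactSupport_gradient.comp_left (g := fun y => inner ℝ y N) (by simp)).mul_left
    have iT : Integrable fun x => g x * inner ℝ (∇ φ x) T :=
      (show Continuous fun x => g x * inner ℝ (∇ φ x) T by fun_prop).integrable_of_hasCompactSupport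
        (hφ.hasCompactSupport_gradient.comp_left (g := fun y => inner ℝ y T) (by simp)).mul_left
    have kN := hφ.integral_mul_inner_gradient hfc (by fun_prop) hfd
    have kT := hφ.integral_mul_inner_gradient hgc (by fun_prop) hgd
    calc ∫ x in Ω, inner ℝ (pFlux p (w.1.2 x)) (∇ φ x)
        = ∫ x in Ω, inner ℝ (pFlux p (G x)) (∇ φ x) :=
          integral_congr_ae (hw.mono fun x hx => by simp only [hx])
      _ = ∫ x, inner ℝ (pFlux p (G x)) (∇ φ x) :=
          setIntegral_eq_integral_of_forall_compl_eq_zero fun x hx => by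
            rw [hφ.gradient_eq_zero hx, inner_zero_right]
      _ = ∫ x, -‖N‖ ^ (p - 2) * (f x * inner ℝ (∇ φ x) N + g x * inner ℝ (∇ φ x) T) := by
          refine integral_congr_ae (ae_of_all _ fun x => ?_)
          simp only [hflux, real_inner_smul_left, inner_add_left]
          rw [real_inner_comm (∇ φ x) N, real_inner_comm (∇ φ x) T]
      _ = 0 := by
          rw [integral_const_mul, integral_add iN iT, kN, kT, ← neg_add, ← integral_add]
          · simp
          · exact (show Continuous fun x => -((p - 1) * ‖N‖ ^ 2 * f x) * φ x by
              fun_prop).integrable_of_hasCompactSupport hφ.2.1.mul_left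
          · exact (show Continuous fun x => ((p - 1) * ‖N‖ ^ 2 * f x) * φ x by
              fun_prop).integrable_of_hasCompactSupport hφ.2.1.mul_left

end WolffSolution

/-! ### Energy comparison, concentration and determination of the weight. -/

section Determination

section Comparison

variable {α E : Type*} [MeasurableSpace α] {μ : Measure α} {p : ℝ} [hp : Fact (1 < p)]
  [NormedAddCommGroup E] {σ : α → ℝ} {m M : ℝ} {B : Set α}

theorem IsBoundedWeight.lpEnergy_le (h : IsBoundedWeight μ σ m M) {a : ℝ} (ha : 0 < a)
    (hB : MeasurableSet B) (hσ : ∀ᵐ x ∂μ, x ∈ B → σ x ≤ a) (H : Lp E (ENNReal.ofReal p) μ) :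
    lpEnergy σ H ≤ a * (∫ x, ‖H x‖ ^ p ∂μ) +
      M * ∫ x, Bᶜ.indicator (fun x => ‖H x‖ ^ p) x ∂μ := by
  have iH : Integrable (fun x => ‖H x‖ ^ p) μ := integrable_norm_rpow_of_memLp (Lp.memLp H)
  have iB : Integrable (fun x => Bᶜ.indicator (fun x => ‖H x‖ ^ p) x) μ := iH.indicator hB.compl
  rw [← integral_const_mul, ← integral_const_mul, ← integral_add (iH.const_mul a)
    (iB.const_mul M)]
  refine integral_mono_ae (h.integrable_energy H) ((iH.const_mul a).add (iB.const_mul M)) ?_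
  filter_upwards [hσ, h.upper] with x hx hM
  have hH : 0 ≤ ‖H x‖ ^ p := by positivity
  by_cases hxB : x ∈ B
  · rw [indicator_of_notMem (by simpa using hxB), mul_zero, add_zero]
    exact mul_le_mul_of_nonneg_right (hx hxB) hH
  · rw [indicator_of_mem (by simpa using hxB)]
    have := mul_le_mul_of_nonneg_right hM hH
    have := mul_nonneg ha.le hH
    linarith

/-- The hypothesis `hHU` lets a multiple of the pairing of `pFlux p (H x)` with `U - H` be added at
no cost. Weighted Young then applies pointwise: with weight `b` on `B`, where the `H` terms cancel
exactly, and with weight `m` off `B`, which produces the error term. -/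
theorem IsBoundedWeight.mul_integral_le_lpEnergy [InnerProductSpace ℝ E]
    (h : IsBoundedWeight μ σ m M) {b : ℝ} (hb : 0 < b)
    (hB : MeasurableSet B) (hσ : ∀ᵐ x ∂μ, x ∈ B → b ≤ σ x) (H U : Lp E (ENNReal.ofReal p) μ)
    (hHU : ∫ x, inner ℝ (pFlux p (H x)) ((U - H) x) ∂μ = 0) :
    b * (∫ x, ‖H x‖ ^ p ∂μ) ≤ lpEnergy σ U + (p - 1) * (m * (b / m) ^ (p / (p - 1))) *
      ∫ x, Bᶜ.indicator (fun x => ‖H x‖ ^ p) x ∂μ := by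
  have hp1 : 0 < p - 1 := by linarith [hp.out]
  have hm0 := h.pos
  set K : ℝ := m * (b / m) ^ (p / (p - 1)) with hK
  have iH : Integrable (fun x => ‖H x‖ ^ p) μ := integrable_norm_rpow_of_memLp (Lp.memLp H)
  have iB : Integrable (fun x => Bᶜ.indicator (fun x => ‖H x‖ ^ p) x) μ := iH.indicator hB.compl
  have i1 := (isBoundedWeight_one μ).integrable_inner_flux H (U - H)
  simp only [one_mul] at i1
  have i2 := h.integrable_energy U
  have hz : b * (∫ x, ‖H x‖ ^ p ∂μ) = ∫ x, (b * ‖H x‖ ^ p +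
      p * b * inner ℝ (pFlux p (H x)) ((U - H) x)) ∂μ := by
    rw [integral_add (iH.const_mul b) (i1.const_mul (p * b)), integral_const_mul,
      integral_const_mul, hHU, mul_zero, add_zero]
  rw [hz, ← integral_const_mul, lpEnergy, ← integral_add i2 (iB.const_mul ((p - 1) * K))]
  refine integral_mono_ae ((iH.const_mul b).add (i1.const_mul (p * b)))
    (i2.add (iB.const_mul ((p - 1) * K))) ?_
  filter_upwards [hσ, h.lower, Lp.coeFn_sub U H] with x hx hm hs
  have hH : 0 ≤ ‖H x‖ ^ p := by positivity
  have hU : 0 ≤ ‖U x‖ ^ p := by positivity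
  rw [hs, Pi.sub_apply, inner_sub_right, inner_pFlux_self hp.out]
  by_cases hxB : x ∈ B
  · rw [indicator_of_notMem (by simpa using hxB), mul_zero, add_zero]
    have h3 := mul_inner_pFlux_le hp.out hb hb (H x) (U x)
    rw [div_self hb.ne', Real.one_rpow, mul_one] at h3
    have h4 := mul_le_mul_of_nonneg_right (hx hxB) hU
    linarith
  · rw [indicator_of_mem (by simpa using hxB)]
    have h3 := mul_inner_pFlux_le hp.out hb hm0 (H x) (U x)
    have h4 := mul_le_mul_of_nonneg_right hm hU
    have h5 := mul_nonneg (mul_nonneg hp1.le hb.le) hH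
    rw [← hK] at h3
    linarith

/-- A field of exponential size `e^{-t}` concentrates its energy where `t` is small. -/
theorem mul_exp_le_of_energy_le [IsFiniteMeasure μ] {H : Lp E (ENNReal.ofReal p) μ} {t : α → ℝ}
    {k κ d₁ d₂ q Q : ℝ} (hκ : 0 < κ) (hq : 0 ≤ q) (hQ : 0 ≤ Q)
    (hH : ∀ᵐ x ∂μ, Real.exp (-k) * (κ * Real.exp (-t x)) ≤ ‖H x‖ ∧
      ‖H x‖ ≤ Real.exp k * (κ * Real.exp (-t x)))
    {A : Set α} (hA : MeasurableSet A) (htA : ∀ x ∈ A, t x ≤ d₁)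
    (hB : MeasurableSet B) (htB : ∀ᵐ x ∂μ, x ∉ B → d₂ ≤ t x)
    (h : q * ∫ x, ‖H x‖ ^ p ∂μ ≤ Q * ∫ x, Bᶜ.indicator (fun x => ‖H x‖ ^ p) x ∂μ) :
    q * μ.real A * Real.exp ((d₂ - d₁ - 2 * k) * p) ≤ Q * μ.real univ := by
  have hp0 : 0 < p := by linarith [hp.out]
  have iH : Integrable (fun x => ‖H x‖ ^ p) μ := integrable_norm_rpow_of_memLp (Lp.memLp H)
  have hin : μ.real A * (Real.exp (-k) * (κ * Real.exp (-d₁))) ^ p ≤ ∫ x, ‖H x‖ ^ p ∂μ := by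
    rw [← smul_eq_mul, ← setIntegral_const]
    refine le_trans (integral_mono_ae (integrable_const _) iH.restrict ?_)
      (setIntegral_le_integral iH (ae_of_all _ fun x => by positivity))
    filter_upwards [ae_restrict_mem hA, ae_restrict_of_ae hH] with x hxA hx
    refine Real.rpow_le_rpow (by positivity) (le_trans ?_ hx.1) hp0.le
    have := htA x hxA
    gcongr
  have hout : ∫ x, Bᶜ.indicator (fun x => ‖H x‖ ^ p) x ∂μ ≤
      μ.real univ * (Real.exp k * (κ * Real.exp (-d₂))) ^ p := by
    rw [← smul_eq_mul, ← integral_const]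
    refine integral_mono_ae (iH.indicator hB.compl) (integrable_const _) ?_
    filter_upwards [htB, hH] with x ht hx
    by_cases hxB : x ∈ B
    · rw [indicator_of_notMem (by simpa using hxB)]
      positivity
    · rw [indicator_of_mem (by simpa using hxB)]
      refine Real.rpow_le_rpow (norm_nonneg _) (hx.2.trans ?_) hp0.le
      have := ht hxB
      gcongr
  -- Dividing by this common factor eliminates `κ`, so only the gap `d₂ - d₁` and the comparability
  -- loss `2k` remain in the final exponent.
  set Z : ℝ := (Real.exp k * (κ * Real.exp (-d₂))) ^ p with hZ
  have hZ0 : 0 < Z := by positivity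
  have hrel : (Real.exp (-k) * (κ * Real.exp (-d₁))) ^ p =
      Real.exp ((d₂ - d₁ - 2 * k) * p) * Z := by
    rw [hZ, Real.exp_mul, ← Real.mul_rpow (by positivity) (by positivity)]
    congr 1
    have h4 : ∀ x y : ℝ, Real.exp x * (κ * Real.exp y) = κ * Real.exp (x + y) := fun x y => by
      rw [Real.exp_add]; ring
    rw [h4, h4, mul_left_comm, ← Real.exp_add]
    congr 2
    ring
  rw [hrel] at hin
  refine le_of_mul_le_mul_right ?_ hZ0
  calc _ = q * (μ.real A * (Real.exp ((d₂ - d₁ - 2 * k) * p) * Z)) := by ring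
    _ ≤ q * ∫ x, ‖H x‖ ^ p ∂μ := mul_le_mul_of_nonneg_left hin hq
    _ ≤ _ := h
    _ ≤ Q * (μ.real univ * Z) := mul_le_mul_of_nonneg_left hout hQ
    _ = _ := by ring

end Comparison

variable {n : ℕ} {p : ℝ} {Ω : Set (EuclideanSpace ℝ (Fin n))} [hp : Fact (1 < p)]
  {σ₁ σ₂ : EuclideanSpace ℝ (Fin n) → ℝ}

/-- Comparison of the minimal energies for the boundary values of a `p`-harmonic function `w`:
the difference of the weights on `B` is controlled by the energy of `w` outside `B`. -/
theorem mul_integral_le_of_dnMap_eq (hn : 0 < n) (hΩ : Bornology.IsBounded Ω) {m₁ M₁ m₂ M₂ : ℝ}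
    (h₁ : IsBoundedWeight (volume.restrict Ω) σ₁ m₁ M₁)
    (h₂ : IsBoundedWeight (volume.restrict Ω) σ₂ m₂ M₂) (hΛ : dnMap p Ω σ₁ = dnMap p Ω σ₂)
    {a b : ℝ} (ha : 0 < a) (hb : 0 < b) {B : Set (EuclideanSpace ℝ (Fin n))} (hB : MeasurableSet B)
    (hσ₁ : ∀ᵐ x ∂volume.restrict Ω, x ∈ B → σ₁ x ≤ a)
    (hσ₂ : ∀ᵐ x ∂volume.restrict Ω, x ∈ B → b ≤ σ₂ x) {w : SobolevW p Ω}
    (hw : ∀ v ∈ SobolevW0 p Ω, ∫ x in Ω, inner ℝ (pFlux p (w.1.2 x)) (v.1.2 x) = 0) :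
    (b - a) * ∫ x in Ω, ‖w.1.2 x‖ ^ p ≤
      (M₁ + (p - 1) * (m₂ * (b / m₂) ^ (p / (p - 1)))) *
        ∫ x in Ω, Bᶜ.indicator (fun x => ‖w.1.2 x‖ ^ p) x := by
  obtain ⟨u₁, hu₁, e₁⟩ := exists_isSolution_dnMap_eq hn hΩ h₁ w
  obtain ⟨u₂, hu₂, e₂⟩ := exists_isSolution_dnMap_eq hn hΩ h₂ w
  have hE : lpEnergy σ₂ u₂.1.2 = dirichletEnergy σ₁ u₁ := by
    rw [← e₁, hΛ, e₂]
    rfl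
  have hup := h₁.lpEnergy_le ha hB hσ₁ w.1.2
  have hlow := h₂.mul_integral_le_lpEnergy hb hB hσ₂ w.1.2 u₂.1.2
    (hw _ (sobolevTrace_eq_iff.1 hu₂.1))
  have hmin : dirichletEnergy σ₁ u₁ ≤ lpEnergy σ₁ w.1.2 := hu₁.2 w rfl
  rw [hE] at hlow
  rw [sub_mul, add_mul]
  linarith

/-- Here dimension at least two is needed: Wolff's solutions require a direction orthogonal to the
direction of decay. -/
theorem exists_inner_eq_zero_norm_eq {E : Type*} [NormedAddCommGroup E] [InnerProductSpace ℝ E]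
    [FiniteDimensional ℝ E] (hE : 2 ≤ Module.finrank ℝ E) (x : E) :
    ∃ y : E, inner ℝ x y = 0 ∧ ‖y‖ = ‖x‖ := by
  have h1 := Submodule.finrank_add_finrank_orthogonal (ℝ ∙ x)
  have h2 : Module.finrank ℝ (ℝ ∙ x) ≤ 1 := (finrank_span_le_card {x}).trans (by simp)
  have h3 : (ℝ ∙ x)ᗮ ≠ ⊥ := fun h => by
    rw [h, finrank_bot] at h1
    omega
  obtain ⟨y, hy, hy0⟩ := Submodule.exists_mem_ne_zero_of_ne_bot h3
  have hxy : inner ℝ x y = 0 := Submodule.mem_orthogonal_singleton_iff_inner_right.1 hy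
  refine ⟨(‖x‖ / ‖y‖) • y, by rw [real_inner_smul_right, hxy, mul_zero], ?_⟩
  rw [norm_smul, Real.norm_of_nonneg (by positivity), div_mul_cancel₀ _ (norm_ne_zero_iff.2 hy0)]

/-- At a boundary point of a strictly convex closed set with nonempty interior there is a
supporting hyperplane that touches the set in no other point. -/
theorem StrictConvex.exists_inner_sub_pos {E : Type*} [NormedAddCommGroup E]
    [InnerProductSpace ℝ E] [CompleteSpace E] {s : Set E} (hs : StrictConvex ℝ s)
    (hne : (interior s).Nonempty) {x₀ : E} (hx₀ : x₀ ∈ s) (hx₀' : x₀ ∉ interior s) :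
    ∃ v : E, v ≠ 0 ∧ ∀ x ∈ s, x ≠ x₀ → 0 < inner ℝ v (x - x₀) := by
  obtain ⟨f, hf⟩ := geometric_hahn_banach_open_point hs.convex.interior isOpen_interior hx₀'
  have hv : ∀ y, inner ℝ (-(InnerProductSpace.toDual ℝ E).symm f) y = -f y := fun y => by
    rw [inner_neg_left, InnerProductSpace.toDual_symm_apply]
  refine ⟨-(InnerProductSpace.toDual ℝ E).symm f, fun h => ?_, fun x hx hne => ?_⟩
  · obtain ⟨y, hy⟩ := hne
    have h1 := hv y
    have h2 := hv x₀
    rw [h, inner_zero_left] at h1 h2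
    linarith [hf y hy]
  -- By strict convexity the midpoint of `x` and `x₀` is interior, so `f` is strictly below `f x₀`
  -- there, and therefore also at `x`.
  · have h1 := hf _ (hs hx hx₀ hne (by norm_num : (0 : ℝ) < 1 / 2) (by norm_num : (0 : ℝ) < 1 / 2)
      (by norm_num))
    rw [map_add, map_smul, map_smul, smul_eq_mul, smul_eq_mul] at h1
    rw [hv, map_sub]
    linarith

theorem ContinuousOn.exists_isBoundedWeight {σ : EuclideanSpace ℝ (Fin n) → ℝ} (hΩo : IsOpen Ω)
    (hΩb : Bornology.IsBounded Ω) (hc : ContinuousOn σ (closure Ω))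
    (hpos : ∀ x ∈ closure Ω, 0 < σ x) : ∃ m M, IsBoundedWeight (volume.restrict Ω) σ m M := by
  obtain ⟨m, hm, hm'⟩ := hΩb.isCompact_closure.exists_forall_le' hc hpos
  obtain ⟨M, hM⟩ := hΩb.isCompact_closure.bddAbove_image hc
  exact ⟨m, M, (hc.mono subset_closure).aestronglyMeasurable hΩo.measurableSet, hm,
    ae_restrict_of_forall_mem hΩo.measurableSet fun x hx => hm' x (subset_closure hx),
    ae_restrict_of_forall_mem hΩo.measurableSet fun x hx => hM ⟨x, subset_closure hx, rfl⟩⟩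

theorem le_of_dnMap_eq (hn : 2 ≤ n) (hΩo : IsOpen Ω) (hΩb : Bornology.IsBounded Ω)
    (hΩc : StrictConvex ℝ (closure Ω))
    (hσ₁c : ContinuousOn σ₁ (closure Ω)) (hσ₁p : ∀ x ∈ closure Ω, 0 < σ₁ x)
    (hσ₂c : ContinuousOn σ₂ (closure Ω)) (hσ₂p : ∀ x ∈ closure Ω, 0 < σ₂ x)
    (hΛ : dnMap p Ω σ₁ = dnMap p Ω σ₂) {x₀ : EuclideanSpace ℝ (Fin n)}
    (hx₀ : x₀ ∈ frontier (closure Ω)) : σ₂ x₀ ≤ σ₁ x₀ := by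
  by_contra! hlt
  have hp0 : 0 < p := by linarith [hp.out]
  have hcl : x₀ ∈ closure Ω := by
    have := hx₀.1
    rwa [closure_closure] at this
  have hsub : Ω ⊆ interior (closure Ω) := hΩo.subset_interior_closure
  obtain ⟨v, hv0, hv⟩ := hΩc.exists_inner_sub_pos
    ((closure_nonempty_iff.1 ⟨x₀, hcl⟩).mono hsub) hcl hx₀.2
  obtain ⟨e, hve, hen⟩ := exists_inner_eq_zero_norm_eq (by simpa using hn) v
  obtain ⟨m₁, M₁, h₁⟩ := hσ₁c.exists_isBoundedWeight hΩo hΩb hσ₁p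
  obtain ⟨m₂, M₂, h₂⟩ := hσ₂c.exists_isBoundedWeight hΩo hΩb hσ₂p
  obtain ⟨a, ha1, hab'⟩ := exists_between hlt
  obtain ⟨b, hab, hb2⟩ := exists_between hab'
  have ha0 : 0 < a := (hσ₁p x₀ hcl).trans ha1
  have hb0 : 0 < b := ha0.trans hab
  obtain ⟨ρ, hρ, hball⟩ := Metric.mem_nhdsWithin_iff.1
    (((hσ₁c x₀ hcl).eventually_lt_const ha1).and ((hσ₂c x₀ hcl).eventually_const_lt hb2))
  -- Compactness turns strict positivity away from `x₀` into a uniform lower bound off the ball. The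
  -- set `A` below uses `d / 2`, which leaves an exponential gap.
  obtain ⟨d, hd0, hd⟩ := (hΩb.isCompact_closure.diff (Metric.isOpen_ball (x := x₀) (ε := ρ))
    ).exists_forall_le' (f := fun x => inner ℝ v (x - x₀)) (a := 0) (by fun_prop) fun x hx =>
      hv x hx.1 fun h => hx.2 (by rw [h]; exact Metric.mem_ball_self hρ)
  set A : Set (EuclideanSpace ℝ (Fin n)) := Ω ∩ {x | inner ℝ v (x - x₀) < d / 2} with hA
  have hopen : IsOpen {x : EuclideanSpace ℝ (Fin n) | inner ℝ v (x - x₀) < d / 2} :=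
    isOpen_lt (by fun_prop) continuous_const
  have hAo : IsOpen A := hΩo.inter hopen
  have hAne : A.Nonempty := by
    rw [hA, inter_comm]
    exact mem_closure_iff.1 hcl _ hopen (by simpa using hd0)
  have hΩfin : volume Ω ≠ ⊤ := hΩb.measure_lt_top.ne
  have : IsFiniteMeasure (volume.restrict Ω) := ⟨by simpa using hΩfin.lt_top⟩
  have hAfin : volume A ≠ ⊤ := measure_ne_top_of_subset inter_subset_left hΩfin
  have hApos : 0 < volume.real A :=
    ENNReal.toReal_pos (hAo.measure_pos volume hAne).ne' hAfin
  obtain ⟨k, hk⟩ := exists_wolffSolution p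
  set Q : ℝ := M₁ + (p - 1) * (m₂ * (b / m₂) ^ (p / (p - 1))) with hQ
  have hm₂ := h₂.pos
  have hp1 : 0 < p - 1 := by linarith [hp.out]
  -- The weight bounds hold only almost everywhere, so the sign of `M₁` relies on `Ω` having
  -- positive measure.
  have hM₁ : 0 ≤ M₁ := by
    have : (volume.restrict Ω) ≠ 0 := by
      rw [Ne, Measure.restrict_eq_zero]
      exact (hΩo.measure_pos volume (hAne.mono inter_subset_left)).ne'
    have := ae_neBot.2 this
    obtain ⟨x, hx⟩ := h₁.norm_le.exists
    exact (norm_nonneg _).trans hx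
  have hQ0 : 0 ≤ Q := by positivity
  -- The right side and all constants are independent of `τ`, while the left side grows
  -- exponentially; this is the contradiction.
  have hbound : ∀ τ : ℝ, 0 < τ → (b - a) * volume.real A * Real.exp ((τ * (d / 2) - 2 * k) * p) ≤
      Q * volume.real Ω := by
    intro τ hτ
    obtain ⟨w, hwn, hw⟩ := hk hΩb (τ • v) (τ • e) x₀
      (by rw [real_inner_smul_left, real_inner_smul_right, hve]; simp)
      (by rw [norm_smul, norm_smul, hen])
    have hN : ‖τ • v‖ = τ * ‖v‖ := by rw [norm_smul, Real.norm_of_nonneg hτ.le]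
    simp only [hN, real_inner_smul_left] at hwn
    set κ : ℝ := τ * ‖v‖ with hκ
    have hκ0 : 0 < κ := mul_pos hτ (norm_pos_iff.2 hv0)
    have key := mul_integral_le_of_dnMap_eq (by omega) hΩb h₁ h₂ hΛ ha0 hb0
      (Metric.isOpen_ball (x := x₀) (ε := ρ)).measurableSet
      (ae_restrict_of_forall_mem hΩo.measurableSet fun x hx hxB =>
        (hball ⟨hxB, subset_closure hx⟩).1.le)
      (ae_restrict_of_forall_mem hΩo.measurableSet fun x hx hxB =>
        (hball ⟨hxB, subset_closure hx⟩).2.le) hw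
    have h3 := mul_exp_le_of_energy_le (d₁ := τ * (d / 2)) (d₂ := τ * d) hκ0 (sub_nonneg.2 hab.le)
      hQ0 hwn hAo.measurableSet (fun x hx => mul_le_mul_of_nonneg_left hx.2.le hτ.le)
      (Metric.isOpen_ball (x := x₀) (ε := ρ)).measurableSet
      (ae_restrict_of_forall_mem hΩo.measurableSet fun x hx hxB =>
        mul_le_mul_of_nonneg_left (hd x ⟨subset_closure hx, hxB⟩) hτ.le) key
    have h4 : (volume.restrict Ω).real A = volume.real A := by
      rw [measureReal_restrict_apply hAo.measurableSet, inter_eq_left.2 inter_subset_left]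
    rw [h4, measureReal_restrict_apply MeasurableSet.univ, univ_inter] at h3
    convert h3 using 4
    ring
  have htend : Filter.Tendsto
      (fun τ : ℝ => (b - a) * volume.real A * Real.exp ((τ * (d / 2) - 2 * k) * p))
      Filter.atTop Filter.atTop := by
    refine Filter.Tendsto.const_mul_atTop (mul_pos (by linarith) hApos)
      (Real.tendsto_exp_atTop.comp (Filter.Tendsto.atTop_mul_const hp0 ?_))
    exact Filter.tendsto_atTop_add_const_right _ _
      (Filter.tendsto_id.atTop_mul_const (by linarith))
  obtain ⟨τ, hτ, hτ0⟩ := ((htend.eventually_gt_atTop (Q * volume.real Ω)).and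
    (Filter.eventually_gt_atTop 0)).exists
  exact absurd (hbound τ hτ0) (not_le.2 hτ)

end Determination

theorem theorem5p1 (n : ℕ) (hn : 2 ≤ n) (p : ℝ) [Fact (1 < p)]
    (Ω : Set (EuclideanSpace ℝ (Fin n))) (hΩo : IsOpen Ω) (hΩb : Bornology.IsBounded Ω)
    (hΩc : StrictConvex ℝ (closure Ω))
    (σ₁ σ₂ : EuclideanSpace ℝ (Fin n) → ℝ)
    (hσ₁c : ContinuousOn σ₁ (closure Ω)) (hσ₁p : ∀ x ∈ closure Ω, 0 < σ₁ x)
    (hσ₂c : ContinuousOn σ₂ (closure Ω)) (hσ₂p : ∀ x ∈ closure Ω, 0 < σ₂ x)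
    (hΛ : dnMap p Ω σ₁ = dnMap p Ω σ₂) :
    EqOn σ₁ σ₂ (frontier (closure Ω)) ∧ (Convex ℝ Ω → EqOn σ₁ σ₂ (frontier Ω)) := by
  have key : EqOn σ₁ σ₂ (frontier (closure Ω)) := fun x hx =>
    le_antisymm (le_of_dnMap_eq hn hΩo hΩb hΩc hσ₂c hσ₂p hσ₁c hσ₁p hΛ.symm hx)
      (le_of_dnMap_eq hn hΩo hΩb hΩc hσ₁c hσ₁p hσ₂c hσ₂p hΛ hx)
  refine ⟨key, fun hconv => ?_⟩
  rcases Ω.eq_empty_or_nonempty with rfl | hne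
  · simp
  · have h : frontier (closure Ω) = frontier Ω := by
      -- A nonempty open convex set is the interior of its closure, so no boundary point is lost by
      -- passing to `closure Ω`.
      rw [frontier, frontier, closure_closure,
        hconv.interior_closure_eq_interior_of_nonempty_interior (by rwa [hΩo.interior_eq])]
    rwa [← h]
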